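/- Let $F$ be a field and $k$ an integer; $H_k$ denotes singular homology with coefficients in $F$ (zero for $k<0$). For a compact topological space $X$, a continuous $f\colon X\to\mathbb R$ and $a<b$, put $X_a=\{x\in X: f(x)\le a\}$ and let $\beta_f(a,b)$ be the rank of the map $H_k(X_a)\to H_k(X_b)$ induced by inclusion. Call $f$ tame if $\beta_f(a,b)<\infty$ for all $a<b$. The persistence diagram $\mathrm{dgm}_k(f)$ of a tame $f$ is the multiset of points of $\{(a,b):a<b\}\cup\{(a,\infty):a\in\mathbb R\}\cup\{\Delta\}$ in which $(a,b)$ has multiplicity $$\min_{\varepsilon>0,\ a+\varepsilon<b-\varepsilon}\bigl(\beta_f(a+\varepsilon,b-\varepsilon)-\beta_f(a-\varepsilon,b-\varepsilon)-\beta_f(a+\varepsilon,b+\varepsilon)+\beta_f(a-\varepsilon,b+\varepsilon)\bigr),$$ $(a,\infty)$ has multiplicity $\min_{\varepsilon>0,\ c>a+\varepsilon}\bigl(\beta_f(a+\varepsilon,c)-\beta_f(a-\varepsilon,c)\bigr)$, and $\Delta$ has (countably) infinite multiplicity. Put $d\bigl((a,b),(a',b')\bigr)=\min\{\max\{|a-a'|,|b-b'|\},\max\{\frac{b-a}2,\frac{b'-a'}2\}\}$,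 $d\bigl((a,\infty),(a',\infty)\bigr)=|a-a'|$, $d\bigl((a,b),\Delta\bigr)=d\bigl(\Delta,(a,b)\bigr)=\frac{b-a}2$, $d(\Delta,\Delta)=0$, and $d=\infty$ in all other cases. The bottleneck distance is $d_B(D,E)=\inf_\sigma\sup_{p\in D}d(p,\sigma(p))$, where $\sigma$ ranges over the multiset bijections $D\to E$. For a continuous $\boldsymbol\varphi=(\varphi_1,\varphi_2)\colon X\to\mathbb R^2$ and $t\in[0,1]$ put $\boldsymbol\varphi^t=(1-t)\varphi_1+t\varphi_2$, and call $\boldsymbol\varphi$ admissible if $\boldsymbol\varphi^t$ is tame for every $t\in[0,1]$. Then, for every compact topological space $X$, the convex matching distance $$\mathrm{cmd}_k(\boldsymbol\varphi,\boldsymbol\psi)=\max_{t\in[0,1]}d_B\bigl(\mathrm{dgm}_k(\boldsymbol\varphi^t),\mathrm{dgm}_k(\boldsymbol\psi^t)\bigr)$$ is well defined for all admissible $\boldsymbol\varphi,\boldsymbol\psi\colon X\to\mathbb R^2$: the bottleneck distances are finite for every $t\in[0,1]$ and the maximum is attained. Moreover $\mathrm{cmd}_k$ is a pseudo-metric on the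 admissible functions on $X$: $\mathrm{cmd}_k(\boldsymbol\varphi,\boldsymbol\psi)\ge0$, $\mathrm{cmd}_k(\boldsymbol\varphi,\boldsymbol\psi)=\mathrm{cmd}_k(\boldsymbol\psi,\boldsymbol\varphi)$, $\mathrm{cmd}_k(\boldsymbol\varphi,\boldsymbol\varphi)=0$ and $\mathrm{cmd}_k(\boldsymbol\varphi,\boldsymbol\psi)\le\mathrm{cmd}_k(\boldsymbol\varphi,\boldsymbol\xi)+\mathrm{cmd}_k(\boldsymbol\xi,\boldsymbol\psi)$. It is not a metric in general: there are a compact space $X$ and admissible $\boldsymbol\varphi\ne\boldsymbol\psi$ on $X$ with $\mathrm{cmd}_k(\boldsymbol\varphi,\boldsymbol\psi)=0$. -/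

import Mathlib

open scoped ENNReal

universe u v

namespace ConvexMatching

open CategoryTheory

/-- Singular homology in degree `k : ℤ` with coefficients in the field `F`, as a functor to
`F`-vector spaces. It is zero in negative degrees. -/
noncomputable def homologyFunctor (F : Type v) [Field F] (k : ℤ) :
    TopCat.{u} ⥤ ModuleCat.{max u v} F :=
  match k with
  | Int.ofNat n =>
      (AlgebraicTopology.singularHomologyFunctor (ModuleCat.{max u v} F) n).obj
        (ModuleCat.of F (ULift.{max u v} F))
  | Int.negSucc _ => (Functor.const _).obj (ModuleCat.of F PUnit)

section Persistence

variable {X : Type u} [TopologicalSpace X]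

/-- The sublevel set `X_a = {x | f x ≤ a}`, as a topological space. -/
def sublevel (f : C(X, ℝ)) (a : ℝ) : TopCat.{u} := TopCat.of {x : X // f x ≤ a}

/-- The inclusion `X_a ⊆ X_b` of sublevel sets, for `a ≤ b`. -/
def sublevelIncl (f : C(X, ℝ)) {a b : ℝ} (hab : a ≤ b) : sublevel f a ⟶ sublevel f b :=
  TopCat.ofHom
    { toFun := fun x => ⟨x.1, x.2.trans hab⟩
      continuous_toFun := continuous_subtype_val.subtype_mk _ }

/-- The `k`-th persistent homology space of `f` at `(a, b)`: the image of the map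
`H_k(X_a) → H_k(X_b)` induced by inclusion. -/
noncomputable def persistentHomology (F : Type v) [Field F] (k : ℤ) (f : C(X, ℝ)) {a b : ℝ}
    (hab : a ≤ b) : Submodule F ((homologyFunctor.{u, v} F k).obj (sublevel f b)) :=
  LinearMap.range ((homologyFunctor.{u, v} F k).map (sublevelIncl f hab)).hom

/-- The `k`-th persistent Betti numbers of `f` at all `(a, b)` with `a < b` are finite. -/
def IsTame (F : Type v) [Field F] (k : ℤ) (f : C(X, ℝ)) : Prop :=
  ∀ (a b : ℝ) (hab : a < b), Module.Finite F (persistentHomology F k f hab.le)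

/-- The `k`-th persistent Betti number of `f` at `(a, b)`. It is only used for `a < b`. -/
noncomputable def betti (F : Type v) [Field F] (k : ℤ) (f : C(X, ℝ)) (a b : ℝ) : ℕ :=
  if hab : a ≤ b then Module.finrank F (persistentHomology F k f hab) else 0

end Persistence

/-- The set `Δ⁺ ∪ {(a, ∞) | a ∈ ℝ} ∪ {Δ}` in which persistence diagrams live. -/
inductive Point where
  /-- The point `(a, b)` of `Δ⁺`, where `a < b`. -/
  | proper (a b : ℝ) (hab : a < b)
  /-- The point `(a, ∞)`. -/
  | essential (a : ℝ)
  /-- The diagonal `Δ`, seen as a single point. -/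
  | diag

/-- The extended metric on `Point`. -/
noncomputable def Point.d : Point → Point → ℝ≥0∞
  | .proper a b _, .proper a' b' _ =>
      ENNReal.ofReal (min (max |a - a'| |b - b'|) (max ((b - a) / 2) ((b' - a') / 2)))
  | .essential a, .essential a' => ENNReal.ofReal |a - a'|
  | .proper a b _, .diag => ENNReal.ofReal ((b - a) / 2)
  | .diag, .proper a b _ => ENNReal.ofReal ((b - a) / 2)
  | .diag, .diag => 0
  | _, _ => ⊤

/-- A multiset of points, given by its multiplicity function. -/
abbrev Diagram := Point → ℕ∞

/-- The elements of a multiset of points, a point of multiplicity `m` being listed `m` times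
(countably many times if `m = ∞`). -/
abbrev Diagram.Elem (D : Diagram) : Type := {x : Point × ℕ // (x.2 : ℕ∞) < D x.1}

/-- The bottleneck distance between two multisets of points: the infimum over all multiset
bijections `σ` of the supremum of `d (p, σ p)`. -/
noncomputable def bottleneck (D E : Diagram) : ℝ≥0∞ :=
  ⨅ σ : D.Elem ≃ E.Elem, ⨆ p : D.Elem, Point.d p.1.1 (σ p).1.1

section Persistence

variable {X : Type u} [TopologicalSpace X]

/-- Multiplicity of `(a, b) ∈ Δ⁺`: the minimum, over `ε > 0` with `a + ε < b - ε`, of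
`β(a + ε, b - ε) - β(a - ε, b - ε) - β(a + ε, b + ε) + β(a - ε, b + ε)`. -/
noncomputable def properMult (F : Type v) [Field F] (k : ℤ) (f : C(X, ℝ)) (a b : ℝ) : ℕ :=
  sInf {m : ℕ | ∃ ε : ℝ, 0 < ε ∧ a + ε < b - ε ∧
    (m : ℤ) = (betti F k f (a + ε) (b - ε) : ℤ) - betti F k f (a - ε) (b - ε)
      - betti F k f (a + ε) (b + ε) + betti F k f (a - ε) (b + ε)}

/-- Multiplicity of `(a, ∞)`: the minimum, over `ε > 0` and `c > a + ε`, of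
`β(a + ε, c) - β(a - ε, c)`. -/
noncomputable def essentialMult (F : Type v) [Field F] (k : ℤ) (f : C(X, ℝ)) (a : ℝ) : ℕ :=
  sInf {m : ℕ | ∃ ε c : ℝ, 0 < ε ∧ a + ε < c ∧
    (m : ℤ) = (betti F k f (a + ε) c : ℤ) - betti F k f (a - ε) c}

/-- The `k`-th persistence diagram of `f`, where `Δ` has infinite multiplicity. -/
noncomputable def dgm (F : Type v) [Field F] (k : ℤ) (f : C(X, ℝ)) : Diagram
  | .proper a b _ => properMult F k f a b
  | .essential a => essentialMult F k f a
  | .diag => ⊤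

/-- The function `φ^t = (1 - t) φ₁ + t φ₂`. -/
def convexComb (φ : C(X, ℝ × ℝ)) (t : ℝ) : C(X, ℝ) where
  toFun x := (1 - t) * (φ x).1 + t * (φ x).2
  continuous_toFun := by fun_prop

/-- All convex combinations `φ^t`, `t ∈ [0, 1]`, have finite `k`-th persistent Betti numbers, so
that their `k`-th persistence diagrams are defined. -/
def IsAdmissible (F : Type v) [Field F] (k : ℤ) (φ : C(X, ℝ × ℝ)) : Prop :=
  ∀ t ∈ Set.Icc (0 : ℝ) 1, IsTame F k (convexComb φ t)

/-- The bottleneck distance between the `k`-th persistence diagrams of `φ^t` and `ψ^t`. -/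
noncomputable def sliceDist (F : Type v) [Field F] (k : ℤ) (φ ψ : C(X, ℝ × ℝ)) (t : ℝ) : ℝ≥0∞ :=
  bottleneck (dgm F k (convexComb φ t)) (dgm F k (convexComb ψ t))

/-- The convex matching distance `cmd_k`. -/
noncomputable def cmd (F : Type v) [Field F] (k : ℤ) (φ ψ : C(X, ℝ × ℝ)) : ℝ :=
  sSup ((fun t : ℝ => (sliceDist F k φ ψ t).toReal) '' Set.Icc 0 1)

end Persistence

end ConvexMatching

/-! Everything rests on stability (`bottleneck_dgm_le`): for tame `f`, `g` on a compact space, the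
bottleneck distance of the diagrams is at most `sup |f - g|`. It gives finiteness, and, since `φ^t`
is Lipschitz in `t` uniformly on `X`, it makes the slice distance Lipschitz on `[0, 1]`, so the
maximum is attained. The pseudo-metric axioms pass from the bottleneck distance slice by slice.
Swapping the two points of a discrete space changes a function but not its diagrams, so `cmd` is no
metric.

Stability is proved from ranks alone, without decomposing persistence modules. The Frobenius
inequality says that box counts are nonnegative, so the ranks form an `IsRankFunction`, whose points
are listed by `Bar`. If `|f - g| ≤ δ`, the ranks of `H(f ≤ a) → H(g ≤ b + δ)` are those of the image
of the interleaving map. Its points match into those of `f` with equal births (`exists_rowMatching`)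
and into those of `g` moved by `δ` with equal deaths (`exists_columnMatching`); the other coordinate
moves by at most `2δ`. Combining the two (`exists_matching`) matches all points of persistence above
`2δ` within `δ`. The other points are countably many (`countable_bar`) and cost at most `δ` in any
pairing among themselves and with the diagonal. -/

namespace ConvexMatching

/-! ### Rank functions, box counts and multiplicities -/

section RankFunction

variable {L : Type*} [CompleteLinearOrder L]

/-- Abstract rank functions: `r a b`, for `a < b`, counts the points with birth before `a` and
death after `b`. -/
structure IsRankFunction (r : L → L → ℕ) : Prop where
  bot : ∀ b, r ⊥ b = 0
  top : ∀ a, r a ⊤ = 0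
  box : ∀ {a₁ a₂ b₁ b₂ : L}, a₁ ≤ a₂ → a₂ < b₁ → b₁ ≤ b₂ →
    r a₂ b₂ + r a₁ b₁ ≤ r a₂ b₁ + r a₁ b₂

theorem IsRankFunction.mono_left {r : L → L → ℕ} (hr : IsRankFunction r) {a₁ a₂ b : L}
    (ha : a₁ ≤ a₂) (hb : a₂ < b) : r a₁ b ≤ r a₂ b := by
  have := hr.box ha hb le_top
  rw [hr.top, hr.top] at this
  omega

/-- The number of points with birth in `[a₁, a₂]` and death in `[b₁, b₂]`. -/
def boxCount (r : L → L → ℕ) (a₁ a₂ b₁ b₂ : L) : ℕ :=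
  (r a₂ b₁ + r a₁ b₂) - (r a₂ b₂ + r a₁ b₁)

/-- The larger box is the smaller one plus four boxes of nonnegative count (`e1` to `e4`); `e5`
makes the truncated subtraction exact. -/
theorem IsRankFunction.boxCount_mono {r : L → L → ℕ} (hr : IsRankFunction r)
    {a₁ a₂ b₁ b₂ a₁' a₂' b₁' b₂' : L} (h₁ : a₁ ≤ a₁') (h₂ : a₁' ≤ a₂') (h₃ : a₂' ≤ a₂)
    (h₄ : a₂ < b₁) (h₅ : b₁ ≤ b₁') (h₆ : b₁' ≤ b₂') (h₇ : b₂' ≤ b₂) :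
    boxCount r a₁' a₂' b₁' b₂' ≤ boxCount r a₁ a₂ b₁ b₂ := by
  have e1 := hr.box h₁ ((h₂.trans h₃).trans_lt h₄) (h₅.trans (h₆.trans h₇))
  have e2 := hr.box h₃ h₄ (h₅.trans (h₆.trans h₇))
  have e3 := hr.box h₂ (h₃.trans_lt h₄) h₅
  have e4 := hr.box h₂ (h₃.trans_lt (h₄.trans_le (h₅.trans h₆))) h₇
  have e5 := hr.box h₂ (h₃.trans_lt (h₄.trans_le h₅)) h₆
  unfold boxCount
  omega

/-- The box `[a₁, a₂] × [b₁, b₂]` is a neighbourhood of `(a, b)`. -/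
structure IsBoxAt (a b a₁ a₂ b₁ b₂ : L) : Prop where
  left : a₁ < a ∨ a₁ = ⊥
  lt_left : a < a₂
  lt : a₂ < b₁
  lt_right : b₁ < b
  right : b < b₂ ∨ b₂ = ⊤

theorem le_of_lt_or_bot {a₁ a : L} (h : a₁ < a ∨ a₁ = ⊥) : a₁ ≤ a :=
  h.elim le_of_lt fun h => h ▸ bot_le

theorem le_of_lt_or_top {b b₂ : L} (h : b < b₂ ∨ b₂ = ⊤) : b ≤ b₂ :=
  h.elim le_of_lt fun h => h ▸ le_top

theorem max_lt_or_bot {a₁ a₁' a : L} (h : a₁ < a ∨ a₁ = ⊥) (h' : a₁' < a ∨ a₁' = ⊥) :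
    max a₁ a₁' < a ∨ max a₁ a₁' = ⊥ := by
  rcases max_choice a₁ a₁' with e | e <;> rw [e] <;> assumption

/-- The multiplicity of the point `(a, b)`. -/
noncomputable def mult (r : L → L → ℕ) (a b : L) : ℕ :=
  sInf {m | ∃ a₁ a₂ b₁ b₂, IsBoxAt a b a₁ a₂ b₁ b₂ ∧ boxCount r a₁ a₂ b₁ b₂ = m}

theorem mult_le {r : L → L → ℕ} {a b a₁ a₂ b₁ b₂ : L} (h : IsBoxAt a b a₁ a₂ b₁ b₂) :
    mult r a b ≤ boxCount r a₁ a₂ b₁ b₂ :=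
  Nat.sInf_le ⟨a₁, a₂, b₁, b₂, h, rfl⟩

theorem exists_mult_eq [DenselyOrdered L] (r : L → L → ℕ) {a b : L} (hab : a < b) :
    ∃ a₁ a₂ b₁ b₂, IsBoxAt a b a₁ a₂ b₁ b₂ ∧ boxCount r a₁ a₂ b₁ b₂ = mult r a b := by
  obtain ⟨c, hac, hcb⟩ := exists_between hab
  obtain ⟨d, hcd, hdb⟩ := exists_between hcb
  exact Nat.sInf_mem (s := {m | ∃ a₁ a₂ b₁ b₂, IsBoxAt a b a₁ a₂ b₁ b₂ ∧
    boxCount r a₁ a₂ b₁ b₂ = m}) ⟨_, ⊥, c, d, ⊤, ⟨.inr rfl, hac, hcd, hdb, .inr rfl⟩, rfl⟩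

/-- The number of points with birth `a` and death after `d`. -/
noncomputable def rowCount (r : L → L → ℕ) (a d : L) : ℕ :=
  sInf {m | ∃ a₁ a₂, (a₁ < a ∨ a₁ = ⊥) ∧ a < a₂ ∧ a₂ < d ∧ r a₂ d - r a₁ d = m}

/-- The infimum in `ℕ` is attained, and by monotonicity narrower intervals cannot increase the
increment. Several row counts can thus be read off on one common interval. -/
theorem exists_rowCount_eq [DenselyOrdered L] {r : L → L → ℕ} (hr : IsRankFunction r) {a d : L}
    (had : a < d) : ∃ α₁ α₂, (α₁ < a ∨ α₁ = ⊥) ∧ a < α₂ ∧ α₂ < d ∧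
      ∀ a₁ a₂, α₁ ≤ a₁ → (a₁ < a ∨ a₁ = ⊥) → a < a₂ → a₂ ≤ α₂ →
        r a₂ d = r a₁ d + rowCount r a d := by
  obtain ⟨c, hac, hcd⟩ := exists_between had
  obtain ⟨α₁, α₂, h₁, h₂, h₃, h₄⟩ := Nat.sInf_mem
    (s := {m | ∃ a₁ a₂, (a₁ < a ∨ a₁ = ⊥) ∧ a < a₂ ∧ a₂ < d ∧ r a₂ d - r a₁ d = m})
    ⟨_, ⊥, c, .inr rfl, hac, hcd, rfl⟩
  change _ = rowCount r a d at h₄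
  refine ⟨α₁, α₂, h₁, h₂, h₃, fun a₁ a₂ k₁ k₂ k₃ k₄ => ?_⟩
  have e : rowCount r a d ≤ r a₂ d - r a₁ d :=
    Nat.sInf_le ⟨a₁, a₂, k₂, k₃, k₄.trans_lt h₃, rfl⟩
  have m₁ := hr.mono_left k₁ (((le_of_lt_or_bot k₂).trans_lt (k₃.trans_le k₄)).trans h₃)
  have m₂ := hr.mono_left ((le_of_lt_or_bot k₂).trans k₃.le) (k₄.trans_lt h₃)
  have m₃ := hr.mono_left k₄ h₃
  omega

theorem rowCount_top [DenselyOrdered L] {r : L → L → ℕ} (hr : IsRankFunction r) {a : L}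
    (ha : a < ⊤) : rowCount r a ⊤ = 0 := by
  obtain ⟨α₁, α₂, h₁, h₂, -, h⟩ := exists_rowCount_eq hr ha
  have := h α₁ α₂ le_rfl h₁ h₂ le_rfl
  rw [hr.top, hr.top] at this
  omega

/-- Comparison of row counts from a comparison of all increments. -/
theorem rowCount_le_rowCount [DenselyOrdered L] {r r' : L → L → ℕ} (hr : IsRankFunction r)
    (hr' : IsRankFunction r') {a d d' : L} (hd : a < d) (hd' : a < d')
    (h : ∀ a₁ a₂, a₁ ≤ a₂ → a₂ < d → a₂ < d' → r' a₂ d' + r a₁ d ≤ r a₂ d + r' a₁ d') :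
    rowCount r' a d' ≤ rowCount r a d := by
  obtain ⟨α₁, α₂, h₁, h₂, h₃, h₄⟩ := exists_rowCount_eq hr hd
  obtain ⟨β₁, β₂, k₁, k₂, k₃, k₄⟩ := exists_rowCount_eq hr' hd'
  have l := max_lt_or_bot h₁ k₁
  have m := lt_min h₂ k₂
  have e₁ := h₄ _ _ (le_max_left α₁ β₁) l m (min_le_left α₂ β₂)
  have e₂ := k₄ _ _ (le_max_right α₁ β₁) l m (min_le_right α₂ β₂)
  have := h (max α₁ β₁) (min α₂ β₂) ((le_of_lt_or_bot l).trans m.le)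
    ((min_le_left _ _).trans_lt h₃) ((min_le_right _ _).trans_lt k₃)
  omega

theorem rowCount_anti [DenselyOrdered L] {r : L → L → ℕ} (hr : IsRankFunction r) {a d d' : L}
    (hd : a < d) (hd' : d ≤ d') : rowCount r a d' ≤ rowCount r a d :=
  rowCount_le_rowCount hr hr hd (hd.trans_le hd') fun _ _ h₁ h₂ _ => hr.box h₁ h₂ hd'

/-- On a common birth interval, the drop of the row count from `u` to `v` is the count of a box
around `(a, b)`. -/
theorem rowCount_add_mult_le [DenselyOrdered L] {r : L → L → ℕ} (hr : IsRankFunction r)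
    {a b u v : L} (hau : a < u) (hub : u < b) (hbv : b < v ∨ v = ⊤) :
    rowCount r a v + mult r a b ≤ rowCount r a u := by
  have huv : u ≤ v := hub.le.trans (le_of_lt_or_top hbv)
  obtain ⟨α₁, α₂, h₁, h₂, h₃, h₄⟩ := exists_rowCount_eq hr hau
  obtain ⟨β₁, β₂, k₁, k₂, k₃, k₄⟩ := exists_rowCount_eq hr (hau.trans_le huv)
  have l := max_lt_or_bot h₁ k₁
  have m := lt_min h₂ k₂
  have e₁ := h₄ _ _ (le_max_left α₁ β₁) l m (min_le_left α₂ β₂)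
  have e₂ := k₄ _ _ (le_max_right α₁ β₁) l m (min_le_right α₂ β₂)
  have e₃ := mult_le (r := r) ⟨l, m, (min_le_left α₂ β₂).trans_lt h₃, hub, hbv⟩
  have := hr.box ((le_of_lt_or_bot l).trans m.le) ((min_le_left α₂ β₂).trans_lt h₃) huv
  unfold boxCount at e₃
  omega

/-- Take a box realizing the multiplicity and narrow its birth side until both row counts are
realized; its count cannot grow. -/
theorem exists_rowCount_eq_add_mult [DenselyOrdered L] {r : L → L → ℕ} (hr : IsRankFunction r)
    {a b : L} (hab : a < b) : ∃ u v, a < u ∧ u < b ∧ (b < v ∨ v = ⊤) ∧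
      rowCount r a u = rowCount r a v + mult r a b := by
  obtain ⟨a₁, a₂, u, v, hbox, e⟩ := exists_mult_eq r hab
  have hau := hbox.lt_left.trans hbox.lt
  refine ⟨u, v, hau, hbox.lt_right, hbox.right, le_antisymm ?_
    (rowCount_add_mult_le hr hau hbox.lt_right hbox.right)⟩
  have huv : u ≤ v := hbox.lt_right.le.trans (le_of_lt_or_top hbox.right)
  obtain ⟨α₁, α₂, h₁, h₂, h₃, h₄⟩ := exists_rowCount_eq hr hau
  obtain ⟨β₁, β₂, k₁, k₂, k₃, k₄⟩ := exists_rowCount_eq hr (hau.trans_le huv)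
  have l := max_lt_or_bot hbox.left (max_lt_or_bot h₁ k₁)
  have m := lt_min hbox.lt_left (lt_min h₂ k₂)
  have e₁ := h₄ _ _ ((le_max_left α₁ β₁).trans (le_max_right a₁ _)) l m
    ((min_le_right a₂ _).trans (min_le_left α₂ β₂))
  have e₂ := k₄ _ _ ((le_max_right α₁ β₁).trans (le_max_right a₁ _)) l m
    ((min_le_right a₂ _).trans (min_le_right α₂ β₂))
  have e₃ := hr.boxCount_mono (le_max_left a₁ (max α₁ β₁)) ((le_of_lt_or_bot l).trans m.le)
    (min_le_left a₂ (min α₂ β₂)) hbox.lt le_rfl huv le_rfl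
  rw [e] at e₃
  unfold boxCount at e₃
  omega

/-! ### Points of a rank function and their matching along births -/

/-- The points of the diagram of a rank function, a point of multiplicity `m` being listed `m`
times. -/
abbrev Bar (r : L → L → ℕ) : Type _ :=
  {p : (L × L) × ℕ // p.1.1 < p.1.2 ∧ p.2 < mult r p.1.1 p.1.2}

/-- The birth of a point. -/
abbrev Bar.birth {r : L → L → ℕ} (p : Bar r) : L := p.1.1.1

/-- The death of a point. -/
abbrev Bar.death {r : L → L → ℕ} (p : Bar r) : L := p.1.1.2

/-- The points with a given birth are enumerated by decreasing death. -/
theorem exists_rowIndex [DenselyOrdered L] {r : L → L → ℕ} (hr : IsRankFunction r) :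
    ∃ idx : Bar r → ℕ,
      (∀ p q, p.birth = q.birth → idx p = idx q → p = q) ∧
      (∀ p : Bar r, ∀ u, p.birth < u → u < p.death → idx p < rowCount r p.birth u) ∧
      (∀ p : Bar r, ∀ u, p.death < u → rowCount r p.birth u ≤ idx p) ∧
      (∀ a u n, a < u → n < rowCount r a u → ∃ p : Bar r, p.birth = a ∧ idx p = n) := by
  -- `P` is the row count just above `b`: the copies of `(a, b)` receive the indices from `P` to `P
  -- + mult r a b - 1`.
  have key : ∀ a b, ∃ P, a < b → (∀ v, (b < v ∨ v = ⊤) → rowCount r a v ≤ P) ∧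
      (∃ v, (b < v ∨ v = ⊤) ∧ rowCount r a v = P) ∧
      (∀ u, a < u → u < b → P + mult r a b ≤ rowCount r a u) ∧
      ∃ u, a < u ∧ u < b ∧ rowCount r a u = P + mult r a b := by
    intro a b
    by_cases hab : a < b
    · obtain ⟨u, v, hau, hub, hbv, e⟩ := exists_rowCount_eq_add_mult hr hab
      refine ⟨rowCount r a v, fun _ => ⟨fun v' hv' => ?_, ⟨v, hbv, rfl⟩, fun u' h h' =>
        rowCount_add_mult_le hr h h' hbv, u, hau, hub, e⟩⟩
      have := rowCount_add_mult_le hr hau hub hv'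
      omega
    · exact ⟨0, fun h => absurd h hab⟩
  choose P hP using key
  have lower : ∀ p : Bar r, ∀ u, p.birth < u → u < p.death →
      P p.birth p.death + p.1.2 < rowCount r p.birth u := fun p u h h' => by
    have : P p.birth p.death + mult r p.birth p.death ≤ rowCount r p.birth u :=
      (hP _ _ p.2.1).2.2.1 u h h'
    have : p.1.2 < mult r p.birth p.death := p.2.2
    omega
  have upper : ∀ p : Bar r, ∀ u, p.death < u →
      rowCount r p.birth u ≤ P p.birth p.death + p.1.2 := fun p u h => by
    have : rowCount r p.birth u ≤ P p.birth p.death := (hP _ _ p.2.1).1 u (.inl h)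
    omega
  have anti : ∀ p q : Bar r, p.birth = q.birth → p.death < q.death →
      P q.birth q.death + q.1.2 < P p.birth p.death + p.1.2 := fun p q h h' => by
    obtain ⟨w, hw, hw'⟩ := exists_between h'
    have e₁ := upper p w hw
    have e₂ := lower q w (h ▸ p.2.1.trans hw) hw'
    rw [h] at e₁ ⊢
    omega
  refine ⟨fun p => P p.birth p.death + p.1.2, fun p q h h' => ?_, lower, upper, ?_⟩
  · have hd : p.death = q.death := by
      rcases lt_trichotomy p.death q.death with hlt | heq | hgt
      · exact absurd h' (anti p q h hlt).ne'
      · exact heq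
      · exact absurd h' (anti q p h.symm hgt).ne
    obtain ⟨⟨⟨a, b⟩, i⟩, hp⟩ := p
    obtain ⟨⟨⟨a', b'⟩, i'⟩, hq⟩ := q
    dsimp only [Bar.birth, Bar.death] at h hd h'
    subst h hd
    have : i = i' := by omega
    subst this
    rfl
  · intro a u n hau hn
    -- The point of index `n` dies where the row count stops exceeding `n`; the supremum exists by
    -- completeness and may be `⊤`, where the row count is zero.
    let s : Set L := {u | a < u ∧ n < rowCount r a u}
    have hus : u ≤ sSup s := le_sSup ⟨hau, hn⟩
    have hab : a < sSup s := hau.trans_le hus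
    obtain ⟨-, ⟨v, hbv, hv⟩, -, ⟨w, haw, hwb, hw⟩⟩ := hP a _ hab
    have h₁ : n < P a (sSup s) + mult r a (sSup s) := by
      rw [← hw]
      obtain ⟨w', hw's, hw'⟩ := lt_sSup_iff.1 hwb
      exact hw's.2.trans_le (rowCount_anti hr haw hw'.le)
    have h₂ : P a (sSup s) ≤ n := by
      rw [← hv]
      rcases hbv with hbv | rfl
      · by_contra! hlt
        exact hbv.not_ge (le_sSup ⟨hab.trans hbv, hlt⟩)
      · rw [rowCount_top hr (hab.trans_le le_top)]
        exact n.zero_le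
    refine ⟨⟨((a, sSup s), n - P a (sSup s)), hab, by dsimp only; omega⟩, rfl, ?_⟩
    dsimp only [Bar.birth, Bar.death]
    omega

/-- Points of two diagrams with the same births are matched by their position in the order of
deaths. -/
theorem exists_rowMatching [DenselyOrdered L] {r r' : L → L → ℕ} (hr : IsRankFunction r)
    (hr' : IsRankFunction r') (s : L ≃o L) (hs : ∀ x, x ≤ s x)
    (h₁ : ∀ a₁ a₂ d, a₁ ≤ a₂ → a₂ < d → r' a₂ d + r a₁ d ≤ r a₂ d + r' a₁ d)
    (h₂ : ∀ a₁ a₂ d, a₁ ≤ a₂ → a₂ < d → r a₂ (s d) + r' a₁ d ≤ r' a₂ d + r a₁ (s d)) :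
    ∃ ι : Bar r' → Bar r, Function.Injective ι ∧
      (∀ p, (ι p).birth = p.birth ∧ p.death ≤ (ι p).death ∧ (ι p).death ≤ s p.death) ∧
      ∀ q : Bar r, s q.birth < q.death → q ∈ Set.range ι := by
  obtain ⟨idx, inj, lower, upper, surj⟩ := exists_rowIndex hr
  obtain ⟨idx', inj', lower', upper', surj'⟩ := exists_rowIndex hr'
  have c₁ : ∀ a d, a < d → rowCount r' a d ≤ rowCount r a d := fun a d h =>
    rowCount_le_rowCount hr hr' h h fun a₁ a₂ h h' _ => h₁ a₁ a₂ d h h'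
  have c₂ : ∀ a d, a < d → rowCount r a (s d) ≤ rowCount r' a d := fun a d h =>
    rowCount_le_rowCount hr' hr h (h.trans_le (hs d)) fun a₁ a₂ h h' _ => h₂ a₁ a₂ d h h'
  -- Rows of `r` are at least as full as those of `r'`, so every index used in a row of `r'` is used
  -- in that of `r`.
  have ex : ∀ p : Bar r', ∃ q : Bar r, q.birth = p.birth ∧ idx q = idx' p := fun p => by
    obtain ⟨u, hu, hu'⟩ := exists_between p.2.1
    exact surj _ u _ hu ((lower' p u hu hu').trans_le (c₁ _ _ hu))
  choose ι hι hidx using ex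
  refine ⟨ι, fun p q h => inj' p q ?_ ?_, fun p => ⟨hι p, ?_, ?_⟩, fun q hq => ?_⟩
  · rw [← hι, ← hι, h]
  · rw [← hidx, ← hidx, h]
  -- At a level `u` strictly between the two deaths, the row of `r` would be exhausted at an index
  -- still present in the row of `r'`, against `c₁`. The other bound uses `c₂` likewise.
  · by_contra! hlt
    obtain ⟨u, hu, hu'⟩ := exists_between hlt
    have hau : p.birth < u := hι p ▸ (ι p).2.1.trans hu
    have e₁ := upper _ u hu
    have e₂ := lower' p u hau hu'
    have e₃ := c₁ _ _ hau
    rw [hι, hidx] at e₁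
    omega
  · by_contra! hlt
    obtain ⟨u, hu, hu'⟩ := exists_between hlt
    obtain ⟨w, rfl⟩ := s.surjective u
    rw [s.lt_iff_lt] at hu
    have haw : p.birth < w := p.2.1.trans hu
    have e₁ := upper' _ w hu
    have e₂ := lower (ι p) (s w) (hι p ▸ haw.trans_le (hs w)) hu'
    have e₃ := c₂ _ _ haw
    rw [hι, hidx] at e₂
    omega
  · obtain ⟨u, hu, hu'⟩ := exists_between hq
    obtain ⟨w, rfl⟩ := s.surjective u
    rw [s.lt_iff_lt] at hu
    have e₂ := lower q (s w) (hu.trans_le (hs w)) hu'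
    obtain ⟨p, hp, hp'⟩ := surj' _ w _ hu (e₂.trans_le (c₂ _ _ hu))
    exact ⟨p, inj _ _ ((hι p).trans hp) ((hidx p).trans hp')⟩

/-! ### Duality, reparametrization and algebraic stability -/

open OrderDual in
/-- The rank function with births and deaths exchanged. -/
def dualRank (r : L → L → ℕ) : Lᵒᵈ → Lᵒᵈ → ℕ := fun x y => r (ofDual y) (ofDual x)

theorem IsRankFunction.dual {r : L → L → ℕ} (hr : IsRankFunction r) :
    IsRankFunction (dualRank r) where
  bot _ := hr.top _
  top _ := hr.bot _
  box h₁ h₂ h₃ := by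
    have := hr.box (OrderDual.ofDual_le_ofDual.2 h₃) (OrderDual.ofDual_lt_ofDual.2 h₂)
      (OrderDual.ofDual_le_ofDual.2 h₁)
    unfold dualRank
    omega

open OrderDual in
theorem mult_dualRank (r : L → L → ℕ) (a b : L) :
    mult (dualRank r) (toDual b) (toDual a) = mult r a b := by
  unfold mult
  congr 1
  ext m
  constructor
  · rintro ⟨a₁, a₂, b₁, b₂, h, e⟩
    refine ⟨ofDual b₂, ofDual b₁, ofDual a₂, ofDual a₁,
      ⟨h.right, h.lt_right, h.lt, h.lt_left, h.left⟩, ?_⟩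
    rw [← e]
    unfold boxCount dualRank
    omega
  · rintro ⟨a₁, a₂, b₁, b₂, h, e⟩
    refine ⟨toDual b₂, toDual b₁, toDual a₂, toDual a₁,
      ⟨h.right, h.lt_right, h.lt, h.lt_left, h.left⟩, ?_⟩
    rw [← e]
    unfold boxCount dualRank
    simp only [ofDual_toDual]
    omega

open OrderDual in
/-- Exchanging birth and death. -/
def dualBar (r : L → L → ℕ) : Bar r ≃ Bar (dualRank r) where
  toFun p := ⟨((toDual p.death, toDual p.birth), p.1.2), p.2.1, by
    simpa only [mult_dualRank] using p.2.2⟩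
  invFun p := ⟨((ofDual p.death, ofDual p.birth), p.1.2), p.2.1, by
    have := p.2.2
    rwa [← mult_dualRank]⟩
  left_inv _ := rfl
  right_inv _ := rfl

/-- Points of two diagrams with the same deaths are matched by their position in the order of
births. -/
theorem exists_columnMatching [DenselyOrdered L] {r r' : L → L → ℕ} (hr : IsRankFunction r)
    (hr' : IsRankFunction r') (s : L ≃o L) (hs : ∀ x, x ≤ s x)
    (h₁ : ∀ a b₁ b₂, a < b₁ → b₁ ≤ b₂ → r' a b₁ + r a b₂ ≤ r a b₁ + r' a b₂)
    (h₂ : ∀ a b₁ b₂, a < b₁ → b₁ ≤ b₂ →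
      r (s.symm a) b₁ + r' a b₂ ≤ r' a b₁ + r (s.symm a) b₂) :
    ∃ ι : Bar r' → Bar r, Function.Injective ι ∧
      (∀ p, (ι p).death = p.death ∧ s.symm p.birth ≤ (ι p).birth ∧ (ι p).birth ≤ p.birth) ∧
      ∀ q : Bar r, s q.birth < q.death → q ∈ Set.range ι := by
  -- Reversing the order exchanges births and deaths; `s.symm` is the map lying above the identity
  -- for the reversed order.
  obtain ⟨ι, inj, close, surj⟩ := exists_rowMatching hr.dual hr'.dual s.symm.dual
    (fun x => (s.symm_apply_le).2 (hs _))
    (fun a₁ a₂ d h h' => h₁ _ _ _ h' h) (fun a₁ a₂ d h h' => h₂ _ _ _ h' h)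
  refine ⟨fun p => (dualBar r).symm (ι (dualBar r' p)), ?_, fun p => ?_, fun q hq => ?_⟩
  · exact (dualBar r).symm.injective.comp (inj.comp (dualBar r').injective)
  · obtain ⟨c₁, c₂, c₃⟩ := close (dualBar r' p)
    exact ⟨congrArg OrderDual.ofDual c₁, c₃, c₂⟩
  · obtain ⟨p, hp⟩ := surj (dualBar r q) (by
      have : q.birth < s.symm q.death := (s.lt_symm_apply).2 hq
      exact this)
    refine ⟨(dualBar r').symm p, ?_⟩
    dsimp only
    rw [Equiv.apply_symm_apply, hp, Equiv.symm_apply_apply]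

theorem IsRankFunction.comp_orderIso {r : L → L → ℕ} (hr : IsRankFunction r) (e : L ≃o L) :
    IsRankFunction fun a b => r (e a) (e b) where
  bot _ := by rw [map_bot, hr.bot]
  top _ := by rw [map_top, hr.top]
  box h₁ h₂ h₃ := hr.box (e.monotone h₁) (e.strictMono h₂) (e.monotone h₃)

theorem mult_comp_orderIso (r : L → L → ℕ) (e : L ≃o L) (a b : L) :
    mult (fun a b => r (e a) (e b)) a b = mult r (e a) (e b) := by
  unfold mult
  congr 1
  ext m
  constructor
  · rintro ⟨a₁, a₂, b₁, b₂, h, rfl⟩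
    exact ⟨e a₁, e a₂, e b₁, e b₂, ⟨by simpa using h.left, by simpa using h.lt_left,
      by simpa using h.lt, by simpa using h.lt_right, by simpa using h.right⟩, rfl⟩
  · rintro ⟨a₁, a₂, b₁, b₂, h, rfl⟩
    refine ⟨e.symm a₁, e.symm a₂, e.symm b₁, e.symm b₂, ⟨?_, ?_, ?_, ?_, ?_⟩, by simp [boxCount]⟩
    · simpa [e.symm_apply_lt] using h.left
    · simpa [e.lt_symm_apply] using h.lt_left
    · simpa using h.lt
    · simpa [e.symm_apply_lt] using h.lt_right
    · simpa [e.lt_symm_apply] using h.right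

/-- Reparametrization of the points along an order isomorphism. -/
def compBar (r : L → L → ℕ) (e : L ≃o L) : Bar (fun a b => r (e a) (e b)) ≃ Bar r where
  toFun p := ⟨((e p.birth, e p.death), p.1.2), e.strictMono p.2.1, by
    simpa only [mult_comp_orderIso] using p.2.2⟩
  invFun p := ⟨((e.symm p.birth, e.symm p.death), p.1.2), e.symm.strictMono p.2.1, by
    simpa [mult_comp_orderIso] using p.2.2⟩
  left_inv p := by simp [Bar.birth, Bar.death]
  right_inv p := by simp [Bar.birth, Bar.death]

/-- An algebraic stability theorem: the intermediate rank function `r'` compares to `r₁` along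
births and to a shift of `r₂` along deaths. -/
theorem exists_matching [DenselyOrdered L] {r₁ r₂ r' : L → L → ℕ} (hr₁ : IsRankFunction r₁)
    (hr₂ : IsRankFunction r₂) (hr' : IsRankFunction r') (e : L ≃o L) (he : ∀ x, x ≤ e x)
    (h₁ : ∀ a₁ a₂ d, a₁ ≤ a₂ → a₂ < d → r' a₂ d + r₁ a₁ d ≤ r₁ a₂ d + r' a₁ d)
    (h₂ : ∀ a₁ a₂ d, a₁ ≤ a₂ → a₂ < d →
      r₁ a₂ (e (e d)) + r' a₁ d ≤ r' a₂ d + r₁ a₁ (e (e d)))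
    (h₃ : ∀ a b₁ b₂, a < b₁ → b₁ ≤ b₂ →
      r' a b₁ + r₂ (e a) (e b₂) ≤ r₂ (e a) (e b₁) + r' a b₂)
    (h₄ : ∀ a b₁ b₂, a < b₁ → b₁ ≤ b₂ →
      r₂ (e.symm a) (e b₁) + r' a b₂ ≤ r' a b₁ + r₂ (e.symm a) (e b₂)) :
    ∃ (ι₁ : Bar r' → Bar r₁) (ι₂ : Bar r' → Bar r₂), Function.Injective ι₁ ∧
      Function.Injective ι₂ ∧
      (∀ p, (ι₁ p).birth ≤ e (ι₂ p).birth ∧ (ι₂ p).birth ≤ e (ι₁ p).birth ∧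
        (ι₁ p).death ≤ e (ι₂ p).death ∧ (ι₂ p).death ≤ e (ι₁ p).death) ∧
      (∀ q : Bar r₁, e (e q.birth) < q.death → q ∈ Set.range ι₁) ∧
      (∀ q : Bar r₂, e (e q.birth) < q.death → q ∈ Set.range ι₂) := by
  obtain ⟨ι₁, inj₁, close₁, surj₁⟩ := exists_rowMatching hr₁ hr' (e.trans e)
    (fun x => (he x).trans (he _)) h₁ h₂
  -- Moving `r₂` by `e` centres the one-sided errors: an error of up to `e ∘ e` on one side becomes
  -- at most `e` on either side.
  obtain ⟨ι₂, inj₂, close₂, surj₂⟩ := exists_columnMatching (hr₂.comp_orderIso e) hr' (e.trans e)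
    (fun x => (he x).trans (he _)) h₃ (by simpa using h₄)
  refine ⟨ι₁, fun p => compBar r₂ e (ι₂ p), inj₁, (compBar r₂ e).injective.comp inj₂, fun p => ?_,
    surj₁, fun q hq => ?_⟩
  · obtain ⟨a₁, a₂, a₃⟩ := close₁ p
    obtain ⟨b₁, b₂, b₃⟩ := close₂ p
    refine ⟨?_, ?_, ?_, ?_⟩
    · rw [a₁]
      exact ((e.trans e).symm_apply_le).1 b₂
    · rw [a₁]
      exact e.monotone b₃
    · change _ ≤ e (e (ι₂ p).death)
      rw [b₁]
      exact a₃
    · change e (ι₂ p).death ≤ _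
      rw [b₁]
      exact e.monotone a₂
  · obtain ⟨p, hp⟩ := surj₂ ((compBar r₂ e).symm q) (by
      have : e (q.birth) < e.symm q.death := (e.lt_symm_apply).2 hq
      simpa [compBar, Bar.birth, Bar.death] using this)
    exact ⟨p, by dsimp only; rw [hp, Equiv.apply_symm_apply]⟩

end RankFunction

/-! ### Countability of diagrams -/

/-- A diagram over the extended reals is countable. -/
theorem countable_bar {r : EReal → EReal → ℕ} (hr : IsRankFunction r) : Countable (Bar r) := by
  obtain ⟨idx, inj, -⟩ := exists_rowIndex hr
  -- `J q` holds the births below `q` at which the monotone function `r · q` jumps. A point with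
  -- `birth < q < death` forces such a jump.
  let J : ℚ → Set EReal := fun q => {a | a < ((q : ℝ) : EReal) ∧
    ∀ a₁ a₂, (a₁ < a ∨ a₁ = ⊥) → a < a₂ → a₂ < ((q : ℝ) : EReal) →
      r a₁ ((q : ℝ) : EReal) < r a₂ ((q : ℝ) : EReal)}
  have hJ : ∀ q, (J q).Countable := by
    intro q
    -- The right limit of `r · q` strictly increases along the jumps, so it injects them into `ℕ`.
    let R : EReal → ℕ := fun a =>
      sInf {m | ∃ a₂, a < a₂ ∧ a₂ < ((q : ℝ) : EReal) ∧ r a₂ ((q : ℝ) : EReal) = m}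
    have hlt : ∀ a ∈ J q, ∀ a' ∈ J q, a < a' → R a < R a' := by
      intro a ha a' ha' haa'
      obtain ⟨c, hc, hc'⟩ := exists_between haa'
      obtain ⟨w, hw, hw'⟩ := exists_between ha'.1
      obtain ⟨a₂, h, h', e⟩ := Nat.sInf_mem (s := {m | ∃ a₂, a' < a₂ ∧ a₂ < ((q : ℝ) : EReal) ∧
        r a₂ ((q : ℝ) : EReal) = m}) ⟨_, w, hw, hw', rfl⟩
      change R a < sInf _
      rw [← e]
      have hRc : R a ≤ r c ((q : ℝ) : EReal) := Nat.sInf_le ⟨c, hc, hc'.trans ha'.1, rfl⟩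
      exact hRc.trans_lt (ha'.2 c a₂ (.inl hc') h h')
    have inj : Set.InjOn R (J q) := fun a ha a' ha' h => by
      rcases lt_trichotomy a a' with h' | h' | h'
      · exact absurd h (hlt a ha a' ha' h').ne
      · exact h'
      · exact absurd h (hlt a' ha' a ha h').ne'
    exact Set.countable_iff_exists_injOn.2 ⟨R, inj⟩
  have hA : (⋃ q, J q).Countable := Set.countable_iUnion hJ
  have mem : ∀ p : Bar r, p.birth ∈ ⋃ q, J q := by
    intro p
    obtain ⟨q, hq, hq'⟩ := EReal.exists_rat_btwn_of_lt p.2.1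
    refine Set.mem_iUnion.2 ⟨q, hq, fun a₁ a₂ h₁ h₂ h₃ => ?_⟩
    have hm := mult_le (r := r)
      (IsBoxAt.mk (a := p.birth) (b := p.death) h₁ h₂ h₃ hq' (.inr rfl))
    have := p.2.2
    unfold boxCount at hm
    rw [hr.top, hr.top] at hm
    change _ < mult r p.birth p.death at this
    omega
  have : Countable ↥(⋃ q, J q) := hA.to_subtype
  refine Function.Injective.countable (β := ↥(⋃ q, J q) × ℕ)
    (f := fun p : Bar r => ((⟨p.birth, mem p⟩ : ↥(⋃ q, J q)), idx p)) fun p q h => ?_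
  simp only [Prod.mk.injEq, Subtype.mk.injEq] at h
  exact inj p q h.1 h.2

end ConvexMatching
namespace ConvexMatching

open CategoryTheory

/-! ### The Frobenius rank inequality -/

section LinearAlgebra

variable {F V₁ V₂ V₃ V₄ : Type*} [Field F] [AddCommGroup V₁] [Module F V₁] [AddCommGroup V₂]
  [Module F V₂] [AddCommGroup V₃] [Module F V₃] [AddCommGroup V₄] [Module F V₄]

theorem finrank_map_add_finrank_inf_ker (S : Submodule F V₁) [Module.Finite F S]
    (w : V₁ →ₗ[F] V₂) :
    Module.finrank F (S.map w) + Module.finrank F ↥(S ⊓ LinearMap.ker w) =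
      Module.finrank F S := by
  rw [← LinearMap.finrank_range_add_finrank_ker (w.domRestrict S), LinearMap.range_domRestrict,
    LinearMap.ker_domRestrict, ← Submodule.map_comap_subtype,
    Submodule.finrank_map_subtype_eq]

/-- The Frobenius rank inequality. -/
theorem finrank_range_comp_add_le (x : V₁ →ₗ[F] V₂) (y : V₂ →ₗ[F] V₃) (z : V₃ →ₗ[F] V₄)
    [Module.Finite F (LinearMap.range y)] :
    Module.finrank F (LinearMap.range (z ∘ₗ y)) + Module.finrank F (LinearMap.range (y ∘ₗ x)) ≤
      Module.finrank F (LinearMap.range y) +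
        Module.finrank F (LinearMap.range (z ∘ₗ y ∘ₗ x)) := by
  have hle : LinearMap.range (y ∘ₗ x) ≤ LinearMap.range y := LinearMap.range_comp_le_range x y
  have := Submodule.finiteDimensional_of_le hle
  -- Applying `z` to a subspace `S` loses the dimension of `S ⊓ ker z`, which is monotone in `S`.
  have e₁ := finrank_map_add_finrank_inf_ker (LinearMap.range y) z
  have e₂ := finrank_map_add_finrank_inf_ker (LinearMap.range (y ∘ₗ x)) z
  rw [← LinearMap.range_comp] at e₁ e₂
  have := Submodule.finiteDimensional_of_le
    (inf_le_left : LinearMap.range y ⊓ LinearMap.ker z ≤ LinearMap.range y)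
  have := Submodule.finrank_mono (inf_le_inf_right (LinearMap.ker z) hle)
  omega

end LinearAlgebra

/-! ### Ranks of inclusions in homology -/

section Homology

variable {X : Type u} [TopologicalSpace X] (F : Type v) [Field F] (k : ℤ)

/-- The inclusion of subspaces. -/
def subsetIncl {A B : Set X} (h : A ⊆ B) : TopCat.of A ⟶ TopCat.of B :=
  TopCat.ofHom
    { toFun := fun x => ⟨x.1, h x.2⟩
      continuous_toFun := continuous_subtype_val.subtype_mk _ }

/-- The map on homology induced by an inclusion of subspaces. -/
noncomputable def subsetMap {A B : Set X} (h : A ⊆ B) :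
    (homologyFunctor.{u, v} F k).obj (TopCat.of A) →ₗ[F]
      (homologyFunctor.{u, v} F k).obj (TopCat.of B) :=
  ((homologyFunctor.{u, v} F k).map (subsetIncl h)).hom

theorem subsetMap_comp {A B C : Set X} (h : A ⊆ B) (h' : B ⊆ C) :
    subsetMap F k h' ∘ₗ subsetMap F k h = subsetMap F k (h.trans h') := by
  rw [subsetMap, subsetMap, ← ModuleCat.hom_comp, ← Functor.map_comp]
  rfl

/-- The map on homology induced by an inclusion of subspaces has finite rank. -/
def FiniteRank (A B : Set X) : Prop :=
  ∀ h : A ⊆ B, Module.Finite F (LinearMap.range (subsetMap F k h))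

open scoped Classical in
/-- The rank of the map on homology induced by an inclusion of subspaces. -/
noncomputable def inclRank (A B : Set X) : ℕ :=
  if h : A ⊆ B then Module.finrank F (LinearMap.range (subsetMap F k h)) else 0

variable {F k}

theorem FiniteRank.mono {A A' B B' : Set X} (h : FiniteRank F k A B) (hA : A' ⊆ A) (hAB : A ⊆ B)
    (hB : B ⊆ B') : FiniteRank F k A' B' := by
  intro hA'B'
  have := h hAB
  rw [← subsetMap_comp F k hA (hAB.trans hB), ← subsetMap_comp F k hAB hB]
  have h₁ : LinearMap.range ((subsetMap F k hB ∘ₗ subsetMap F k hAB) ∘ₗ subsetMap F k hA) ≤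
      LinearMap.range (subsetMap F k hB ∘ₗ subsetMap F k hAB) := LinearMap.range_comp_le_range _ _
  rw [LinearMap.range_comp (subsetMap F k hAB)] at h₁
  exact Submodule.finiteDimensional_of_le h₁

/-- This is the Frobenius inequality for a chain of four spaces; only the middle map needs finite
rank. -/
theorem inclRank_box {A₁ A₂ B₁ B₂ : Set X} (h₁ : A₁ ⊆ A₂) (h₂ : A₂ ⊆ B₁) (h₃ : B₁ ⊆ B₂)
    (hf : FiniteRank F k A₂ B₁) :
    inclRank F k A₂ B₂ + inclRank F k A₁ B₁ ≤ inclRank F k A₂ B₁ + inclRank F k A₁ B₂ := by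
  have := hf h₂
  have := finrank_range_comp_add_le (subsetMap F k h₁) (subsetMap F k h₂) (subsetMap F k h₃)
  rw [subsetMap_comp, subsetMap_comp, subsetMap_comp] at this
  simpa only [inclRank, h₁.trans h₂, h₂.trans h₃, h₂, h₁.trans (h₂.trans h₃), dif_pos] using this

theorem inclRank_mono_left {A₁ A₂ B : Set X} (h₁ : A₁ ⊆ A₂) (h₂ : A₂ ⊆ B)
    (hf : FiniteRank F k A₂ B) : inclRank F k A₁ B ≤ inclRank F k A₂ B := by
  have := hf h₂
  rw [inclRank, inclRank, dif_pos h₂, dif_pos (h₁.trans h₂), ← subsetMap_comp F k h₁ h₂]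
  exact Submodule.finrank_mono (LinearMap.range_comp_le_range _ _)

/-- The homology of a finite discrete space is finite-dimensional. -/
theorem finite_homology (Y : TopCat.{u}) [TotallyDisconnectedSpace Y] [Finite Y] :
    Module.Finite F ((homologyFunctor.{u, v} F k).obj Y) := by
  have := Fintype.ofFinite Y
  classical
  match k with
  | Int.ofNat 0 =>
    exact (Module.Finite.equiv_iff
      (AlgebraicTopology.singularHomologyFunctorZeroOfTotallyDisconnectedSpace
        (ModuleCat.{max u v} F) (ModuleCat.of F (ULift.{max u v} F)) Y ≪≫
        ModuleCat.coprodIsoDirectSum _).toLinearEquiv).2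
      (inferInstanceAs (Module.Finite F (DirectSum Y fun _ => ULift.{max u v} F)))
  | Int.ofNat (n + 1) =>
    have := ModuleCat.subsingleton_of_isZero
      (AlgebraicTopology.isZero_singularHomologyFunctor_of_totallyDisconnectedSpace
        (ModuleCat.{max u v} F) (n + 1) (ModuleCat.of F (ULift.{max u v} F)) Y n.succ_ne_zero)
    exact Module.Finite.of_finite (M := (((AlgebraicTopology.singularHomologyFunctor
      (ModuleCat.{max u v} F) (n + 1)).obj (ModuleCat.of F (ULift.{max u v} F))).obj Y))
  | Int.negSucc _ => exact inferInstanceAs (Module.Finite F PUnit.{max u v + 1})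

theorem subsingleton_homology (Y : TopCat.{u}) [IsEmpty Y] :
    Subsingleton ((homologyFunctor.{u, v} F k).obj Y) := by
  classical
  match k with
  | Int.ofNat 0 =>
    exact (AlgebraicTopology.singularHomologyFunctorZeroOfTotallyDisconnectedSpace
        (ModuleCat.{max u v} F) (ModuleCat.of F (ULift.{max u v} F)) Y ≪≫
        ModuleCat.coprodIsoDirectSum _).toLinearEquiv.toEquiv.subsingleton_congr.2
      (inferInstanceAs (Subsingleton (DirectSum Y fun _ => ULift.{max u v} F)))
  | Int.ofNat (n + 1) =>
    exact ModuleCat.subsingleton_of_isZero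
      (AlgebraicTopology.isZero_singularHomologyFunctor_of_totallyDisconnectedSpace
        (ModuleCat.{max u v} F) (n + 1) (ModuleCat.of F (ULift.{max u v} F)) Y n.succ_ne_zero)
  | Int.negSucc _ => exact inferInstanceAs (Subsingleton PUnit.{max u v + 1})

theorem inclRank_empty (B : Set X) : inclRank F k ∅ B = 0 := by
  have := subsingleton_homology (F := F) (k := k) (TopCat.of (∅ : Set X))
  rw [inclRank, dif_pos (Set.empty_subset B), LinearMap.range_eq_bot.2 (Subsingleton.elim _ 0),
    finrank_bot]

theorem finiteRank_empty (B : Set X) : FiniteRank F k ∅ B := by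
  intro h
  have := subsingleton_homology (F := F) (k := k) (TopCat.of (∅ : Set X))
  rw [LinearMap.range_eq_bot.2 (Subsingleton.elim _ 0)]
  infer_instance

end Homology

end ConvexMatching
namespace ConvexMatching

/-! ### Rank functions of sublevel filtrations -/

section SublevelSets

variable {X : Type u} [TopologicalSpace X] {F : Type v} [Field F] {k : ℤ}

/-- Sublevel sets at extended real levels. -/
def sublevelSet (f : C(X, ℝ)) (a : EReal) : Set X := {x | (f x : EReal) ≤ a}

theorem sublevelSet_mono (f : C(X, ℝ)) {a b : EReal} (h : a ≤ b) :
    sublevelSet f a ⊆ sublevelSet f b := fun _ hx => le_trans hx h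

theorem sublevelSet_coe (f : C(X, ℝ)) (a : ℝ) : sublevelSet f a = {x | f x ≤ a} := by
  ext x
  exact EReal.coe_le_coe_iff

theorem sublevelSet_bot (f : C(X, ℝ)) : sublevelSet f ⊥ = ∅ := by
  ext x
  simp [sublevelSet]

variable (F k) in
/-- The rank of the maps from the homology of `P a` to that of `Q b`, less the rank at `b = ⊤`. -/
noncomputable def pairRank (P Q : EReal → Set X) (a b : EReal) : ℕ :=
  if b = ⊤ then 0 else inclRank F k (P a) (Q b)

@[simp]
theorem pairRank_top (P Q : EReal → Set X) (a : EReal) : pairRank F k P Q a ⊤ = 0 := if_pos rfl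

theorem pairRank_of_ne (P Q : EReal → Set X) (a : EReal) {b : EReal} (hb : b ≠ ⊤) :
    pairRank F k P Q a b = inclRank F k (P a) (Q b) := if_neg hb

/-- The value zero at `b = ⊤` turns classes that never die into points with death `⊤`. Two
filtrations are allowed in order to cover the mixed ranks from `f` to `g`. -/
theorem isRankFunction_pairRank {P Q : EReal → Set X} (hP : Monotone P) (hQ : Monotone Q)
    (hbot : P ⊥ = ∅) (hPQ : ∀ a b, a < b → P a ⊆ Q b)
    (hfin : ∀ a b, a < b → b ≠ ⊤ → FiniteRank F k (P a) (Q b)) :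
    IsRankFunction (pairRank F k P Q) where
  bot b := by
    by_cases hb : b = ⊤
    · rw [hb, pairRank_top]
    · rw [pairRank_of_ne _ _ _ hb, hbot, inclRank_empty]
  top a := pairRank_top P Q a
  box {a₁ a₂ b₁ b₂} h₁ h₂ h₃ := by
    by_cases hb₁ : b₁ = ⊤
    · rw [hb₁, top_le_iff] at h₃
      simp [hb₁, h₃]
    · rw [pairRank_of_ne _ _ _ hb₁, pairRank_of_ne _ _ _ hb₁]
      by_cases hb₂ : b₂ = ⊤
      · simpa [hb₂] using inclRank_mono_left (hP h₁) (hPQ _ _ h₂) (hfin _ _ h₂ hb₁)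
      · rw [pairRank_of_ne _ _ _ hb₂, pairRank_of_ne _ _ _ hb₂]
        exact inclRank_box (hP h₁) (hPQ _ _ h₂) (hQ h₃) (hfin _ _ h₂ hb₁)

theorem finiteRank_of_isTame {f : C(X, ℝ)} (hf : IsTame F k f) {a b : EReal} (hab : a < b)
    (hb : b ≠ ⊤) : FiniteRank F k (sublevelSet f a) (sublevelSet f b) := by
  induction a with
  | bot => rw [sublevelSet_bot]; exact finiteRank_empty _
  | top => exact absurd hab not_top_lt
  | coe a =>
    induction b with
    | bot => exact absurd hab not_lt_bot
    | top => exact absurd rfl hb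
    | coe b =>
      rw [sublevelSet_coe, sublevelSet_coe]
      exact fun _ => hf a b (EReal.coe_lt_coe_iff.1 hab)

theorem isRankFunction_of_isTame {f : C(X, ℝ)} (hf : IsTame F k f) :
    IsRankFunction (pairRank F k (sublevelSet f) (sublevelSet f)) :=
  isRankFunction_pairRank (fun _ _ => sublevelSet_mono f) (fun _ _ => sublevelSet_mono f)
    (sublevelSet_bot f) (fun _ _ h => sublevelSet_mono f h.le)
    fun _ _ h h' => finiteRank_of_isTame hf h h'

theorem pairRank_coe (f : C(X, ℝ)) {a b : ℝ} (hab : a ≤ b) :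
    pairRank F k (sublevelSet f) (sublevelSet f) a b = betti F k f a b := by
  rw [pairRank_of_ne _ _ _ (EReal.coe_ne_top b), sublevelSet_coe, sublevelSet_coe, betti,
    dif_pos hab, inclRank,
    dif_pos (show {x | f x ≤ a} ⊆ {x | f x ≤ b} from fun _ hx => le_trans hx hab)]
  rfl

end SublevelSets

/-! ### Agreement of the two notions of multiplicity -/

section Multiplicity

theorem exists_le_sub {a₁ : EReal} {a : ℝ} (h : a₁ < a ∨ a₁ = ⊥) :
    ∃ ε : ℝ, 0 < ε ∧ ∀ ε' ≤ ε, a₁ ≤ ((a - ε' : ℝ) : EReal) := by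
  rcases h with h | rfl
  · obtain ⟨c, hc, hc'⟩ := EReal.lt_iff_exists_real_btwn.1 h
    have := EReal.coe_lt_coe_iff.1 hc'
    exact ⟨a - c, by linarith, fun ε' h => hc.le.trans (EReal.coe_le_coe_iff.2 (by linarith))⟩
  · exact ⟨1, one_pos, fun _ _ => bot_le⟩

theorem exists_add_le {a₂ : EReal} {a : ℝ} (h : (a : EReal) < a₂ ∨ a₂ = ⊤) :
    ∃ ε : ℝ, 0 < ε ∧ ∀ ε' ≤ ε, ((a + ε' : ℝ) : EReal) ≤ a₂ := by
  rcases h with h | rfl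
  · obtain ⟨c, hc, hc'⟩ := EReal.lt_iff_exists_real_btwn.1 h
    have := EReal.coe_lt_coe_iff.1 hc
    exact ⟨c - a, by linarith, fun ε' h => (EReal.coe_le_coe_iff.2 (by linarith)).trans hc'.le⟩
  · exact ⟨1, one_pos, fun _ _ => le_top⟩

variable {X : Type u} [TopologicalSpace X] {F : Type v} [Field F] {k : ℤ} {f : C(X, ℝ)}

theorem boxCount_coe (hf : IsTame F k f) {a₁ a₂ b₁ b₂ : ℝ} (h₁ : a₁ ≤ a₂) (h₂ : a₂ < b₁)
    (h₃ : b₁ ≤ b₂) :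
    (boxCount (pairRank F k (sublevelSet f) (sublevelSet f)) a₁ a₂ b₁ b₂ : ℤ) =
      (betti F k f a₂ b₁ : ℤ) - betti F k f a₁ b₁ - betti F k f a₂ b₂ + betti F k f a₁ b₂ := by
  have := (isRankFunction_of_isTame hf).box (EReal.coe_le_coe_iff.2 h₁)
    (EReal.coe_lt_coe_iff.2 h₂) (EReal.coe_le_coe_iff.2 h₃)
  unfold boxCount
  rw [pairRank_coe f h₂.le, pairRank_coe f (by linarith), pairRank_coe f (by linarith),
    pairRank_coe f (by linarith)] at this ⊢
  omega

theorem boxCount_coe_top (hf : IsTame F k f) {a₁ a₂ b : ℝ} (h₁ : a₁ ≤ a₂) (h₂ : a₂ < b) :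
    (boxCount (pairRank F k (sublevelSet f) (sublevelSet f)) a₁ a₂ b ⊤ : ℤ) =
      (betti F k f a₂ b : ℤ) - betti F k f a₁ b := by
  have := (isRankFunction_of_isTame hf).mono_left (EReal.coe_le_coe_iff.2 h₁)
    (EReal.coe_lt_coe_iff.2 h₂)
  unfold boxCount
  rw [pairRank_coe f h₂.le, pairRank_coe f (by linarith)] at this ⊢
  rw [pairRank_top, pairRank_top]
  omega

/-- Every box around `(a, b)` contains a symmetric one, and smaller boxes have smaller counts, so
both minima agree. -/
theorem properMult_eq (hf : IsTame F k f) {a b : ℝ} (hab : a < b) :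
    properMult F k f a b = mult (pairRank F k (sublevelSet f) (sublevelSet f)) a b := by
  have hr := isRankFunction_of_isTame hf
  apply le_antisymm
  · obtain ⟨a₁, a₂, b₁, b₂, h, e⟩ := exists_mult_eq
      (pairRank F k (sublevelSet f) (sublevelSet f)) (EReal.coe_lt_coe_iff.2 hab)
    obtain ⟨ε₁, p₁, l₁⟩ := exists_le_sub h.left
    obtain ⟨ε₂, p₂, l₂⟩ := exists_add_le (.inl h.lt_left)
    obtain ⟨ε₃, p₃, l₃⟩ := exists_le_sub (.inl h.lt_right)
    obtain ⟨ε₄, p₄, l₄⟩ := exists_add_le h.right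
    obtain ⟨ε, p, q₁, q₂, q₃, q₄⟩ : ∃ ε : ℝ, 0 < ε ∧ ε ≤ ε₁ ∧ ε ≤ ε₂ ∧ ε ≤ ε₃ ∧ ε ≤ ε₄ :=
      ⟨min (min ε₁ ε₂) (min ε₃ ε₄), lt_min (lt_min p₁ p₂) (lt_min p₃ p₄), by simp⟩
    have hlt : a + ε < b - ε :=
      EReal.coe_lt_coe_iff.1 ((l₂ ε q₂).trans_lt (h.lt.trans_le (l₃ ε q₃)))
    rw [← e]
    refine le_trans (Nat.sInf_le ⟨ε, p, hlt, boxCount_coe hf (by linarith) hlt (by linarith)⟩) ?_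
    exact hr.boxCount_mono (l₁ ε q₁) (EReal.coe_le_coe_iff.2 (by linarith)) (l₂ ε q₂) h.lt
      (l₃ ε q₃) (EReal.coe_le_coe_iff.2 (by linarith)) (l₄ ε q₄)
  · refine le_csInf ?_ ?_
    -- The set must be shown nonempty, since `sInf ∅ = 0`; a quarter of the length is an admissible
    -- `ε`.
    · have hlt : a + (b - a) / 4 < b - (b - a) / 4 := by linarith
      exact ⟨_, (b - a) / 4, by linarith, hlt,
        boxCount_coe hf (by linarith) hlt (by linarith)⟩
    · rintro m ⟨ε, p, hlt, e⟩
      rw [← boxCount_coe hf (by linarith) hlt (by linarith), Nat.cast_inj] at e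
      rw [e]
      exact mult_le ⟨.inl (EReal.coe_lt_coe_iff.2 (by linarith)),
        EReal.coe_lt_coe_iff.2 (by linarith), EReal.coe_lt_coe_iff.2 hlt,
        EReal.coe_lt_coe_iff.2 (by linarith), .inl (EReal.coe_lt_coe_iff.2 (by linarith))⟩

/-- A box around `(a, ⊤)` has upper edge `⊤`, where ranks vanish, so two of the four terms drop out;
its lower edge serves as `c`. -/
theorem essentialMult_eq (hf : IsTame F k f) (a : ℝ) :
    essentialMult F k f a = mult (pairRank F k (sublevelSet f) (sublevelSet f)) a ⊤ := by
  have hr := isRankFunction_of_isTame hf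
  apply le_antisymm
  · obtain ⟨a₁, a₂, b₁, b₂, h, e⟩ := exists_mult_eq
      (pairRank F k (sublevelSet f) (sublevelSet f)) (EReal.coe_lt_top a)
    obtain ⟨ε₁, p₁, l₁⟩ := exists_le_sub h.left
    obtain ⟨ε₂, p₂, l₂⟩ := exists_add_le (.inl h.lt_left)
    obtain ⟨ε, p, q₁, q₂⟩ : ∃ ε : ℝ, 0 < ε ∧ ε ≤ ε₁ ∧ ε ≤ ε₂ :=
      ⟨min ε₁ ε₂, lt_min p₁ p₂, by simp⟩
    obtain rfl : b₂ = ⊤ := h.right.elim (fun h => absurd h not_top_lt) id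
    lift b₁ to ℝ using ⟨h.lt_right.ne, (bot_le.trans_lt h.lt).ne'⟩
    have hlt : a + ε < b₁ := EReal.coe_lt_coe_iff.1 ((l₂ ε q₂).trans_lt h.lt)
    rw [← e]
    refine le_trans (Nat.sInf_le ⟨ε, b₁, p, hlt, boxCount_coe_top hf (by linarith) hlt⟩) ?_
    exact hr.boxCount_mono (l₁ ε q₁) (EReal.coe_le_coe_iff.2 (by linarith)) (l₂ ε q₂) h.lt
      le_rfl le_top le_rfl
  · refine le_csInf ?_ ?_
    · exact ⟨_, 1, a + 2, one_pos, by linarith, boxCount_coe_top hf (by linarith) (by linarith)⟩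
    · rintro m ⟨ε, c, p, hlt, e⟩
      rw [← boxCount_coe_top hf (by linarith) hlt, Nat.cast_inj] at e
      rw [e]
      exact mult_le ⟨.inl (EReal.coe_lt_coe_iff.2 (by linarith)),
        EReal.coe_lt_coe_iff.2 (by linarith), EReal.coe_lt_coe_iff.2 hlt,
        EReal.coe_lt_top c, .inr rfl⟩

/-- By compactness `f` is bounded below, so low sublevel sets are empty. This excludes the birth
`⊥`, which no `Point` has. -/
theorem mult_bot [CompactSpace X] (f : C(X, ℝ)) {b : EReal} (hb : ⊥ < b) :
    mult (pairRank F k (sublevelSet f) (sublevelSet f)) ⊥ b = 0 := by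
  obtain ⟨c, hc⟩ := (isCompact_range f.continuous).bddBelow
  obtain ⟨c', -, hc'⟩ := EReal.lt_iff_exists_real_btwn.1 hb
  have hle := mult_le (r := pairRank F k (sublevelSet f) (sublevelSet f))
    (IsBoxAt.mk (a := ⊥) (b := b) (a₁ := ⊥) (a₂ := ((min c c' - 2 : ℝ) : EReal))
      (b₁ := ((min c c' - 1 : ℝ) : EReal)) (.inr rfl) (EReal.bot_lt_coe _)
      (EReal.coe_lt_coe_iff.2 (by linarith))
      ((EReal.coe_lt_coe_iff.2 (by linarith [min_le_right c c'])).trans hc') (.inr rfl))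
  have hempty : sublevelSet f ((min c c' - 2 : ℝ) : EReal) = ∅ := by
    rw [sublevelSet_coe, Set.eq_empty_iff_forall_notMem]
    intro x hx
    have h₁ : c ≤ f x := hc ⟨x, rfl⟩
    have h₂ : f x ≤ min c c' - 2 := hx
    linarith [min_le_left c c']
  rw [boxCount, pairRank_top, pairRank_of_ne _ _ _ (EReal.coe_ne_top _), hempty,
    inclRank_empty] at hle
  omega

end Multiplicity

/-! ### From matchings of points to bottleneck bounds -/

section Diagrams

/-- The diagram `D` is that of the rank function `r`, with the diagonal added. -/
structure Diagram.Represents (D : Diagram) (r : EReal → EReal → ℕ) : Prop where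
  proper : ∀ a b hab, D (.proper a b hab) = mult r a b
  essential : ∀ a, D (.essential a) = mult r a ⊤
  diag : D .diag = ⊤
  mult_bot : ∀ b, ⊥ < b → mult r ⊥ b = 0

theorem represents_dgm {X : Type u} [TopologicalSpace X] [CompactSpace X] {F : Type v} [Field F]
    {k : ℤ} {f : C(X, ℝ)} (hf : IsTame F k f) :
    (dgm F k f).Represents (pairRank F k (sublevelSet f) (sublevelSet f)) where
  proper _ _ hab := congrArg Nat.cast (properMult_eq hf hab)
  essential a := congrArg Nat.cast (essentialMult_eq hf a)
  diag := rfl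
  mult_bot _ hb := ConvexMatching.mult_bot f hb

namespace Diagram.Represents

variable {D : Diagram} {r : EReal → EReal → ℕ}

/-- The elements of a diagram, as points of the rank function and copies of the diagonal. -/
noncomputable def toSum (h : D.Represents r) : D.Elem → Bar r ⊕ ℕ
  | ⟨(.proper a b hab, i), hi⟩ => .inl ⟨((a, b), i), EReal.coe_lt_coe_iff.2 hab, by
      simpa [h.proper] using hi⟩
  | ⟨(.essential a, i), hi⟩ => .inl ⟨((a, ⊤), i), EReal.coe_lt_top a, by
      simpa [h.essential] using hi⟩
  | ⟨(.diag, i), _⟩ => .inr i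

theorem toSum_bijective (h : D.Represents r) : Function.Bijective h.toSum := by
  constructor
  · rintro ⟨⟨_ | _ | _, i⟩, hi⟩ ⟨⟨_ | _ | _, j⟩, hj⟩ e <;> simp [toSum] at e <;> simp [e]
  · rintro (⟨⟨⟨a, b⟩, i⟩, hab, hi⟩ | i)
    · have ha : a ≠ ⊥ := by
        rintro rfl
        rw [h.mult_bot _ hab] at hi
        exact Nat.not_lt_zero _ hi
      lift a to ℝ using ⟨(hab.trans_le le_top).ne, ha⟩
      induction b with
      | bot => exact absurd hab not_lt_bot
      | top => exact ⟨⟨(.essential a, i), by simpa [h.essential] using hi⟩, rfl⟩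
      | coe b =>
        exact ⟨⟨(.proper a b (EReal.coe_lt_coe_iff.1 hab), i), by simpa [h.proper] using hi⟩, rfl⟩
    · exact ⟨⟨(.diag, i), by simp [h.diag]⟩, rfl⟩

end Diagram.Represents

/-- Translation of the extended reals. -/
noncomputable def shift (δ : ℝ) : EReal ≃o EReal where
  toFun x := x + δ
  invFun x := x + (-δ : ℝ)
  left_inv x := by
    dsimp only
    rw [add_assoc, ← EReal.coe_add, add_neg_cancel, EReal.coe_zero, add_zero]
  right_inv x := by
    dsimp only
    rw [add_assoc, ← EReal.coe_add, neg_add_cancel, EReal.coe_zero, add_zero]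
  map_rel_iff' := (EReal.addLECancellable_coe δ).add_le_add_iff_right

@[simp]
theorem shift_coe (δ x : ℝ) : shift δ x = ((x + δ : ℝ) : EReal) := rfl

theorem le_shift {δ : ℝ} (hδ : 0 ≤ δ) (x : EReal) : x ≤ shift δ x :=
  le_add_of_nonneg_right (EReal.coe_nonneg.2 hδ)

/-- As `shift δ` fixes `⊤`, the two deaths are both finite or both infinite, so the infinite values
of `Point.d` do not occur. -/
theorem d_le_of_close {D E : Diagram} {r s : EReal → EReal → ℕ} (hD : D.Represents r)
    (hE : E.Represents s) {δ : ℝ} {p : D.Elem} {q : E.Elem} {P : Bar r} {Q : Bar s}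
    (hp : hD.toSum p = .inl P) (hq : hE.toSum q = .inl Q)
    (h : P.birth ≤ shift δ Q.birth ∧ Q.birth ≤ shift δ P.birth ∧
      P.death ≤ shift δ Q.death ∧ Q.death ≤ shift δ P.death) :
    Point.d p.1.1 q.1.1 ≤ ENNReal.ofReal δ := by
  obtain ⟨⟨_ | _ | _, i⟩, hi⟩ := p <;> obtain ⟨⟨_ | _ | _, j⟩, hj⟩ := q <;>
    simp only [Diagram.Represents.toSum, Sum.inl.injEq, reduceCtorEq] at hp hq <;> subst hp hq <;>
    simp only [Bar.birth, Bar.death, shift_coe, EReal.coe_le_coe_iff, top_le_iff,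
      EReal.coe_ne_top, and_false, false_and, map_top] at h
  · refine ENNReal.ofReal_le_ofReal (min_le_of_left_le (max_le ?_ ?_)) <;> rw [abs_le] <;>
      constructor <;> linarith
  · refine ENNReal.ofReal_le_ofReal ?_
    rw [abs_le]
    constructor <;> linarith

/-- The second term of the minimum in `Point.d` makes points of persistence at most `2δ` cost at
most `δ`, however far apart they are. The unmatched points may thus be paired arbitrarily. -/
theorem d_le_of_short {D E : Diagram} {r s : EReal → EReal → ℕ} (hD : D.Represents r)
    (hE : E.Represents s) {δ : ℝ} {p : D.Elem} {q : E.Elem}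
    (hp : ∀ P, hD.toSum p = .inl P → P.death ≤ shift δ (shift δ P.birth))
    (hq : ∀ Q, hE.toSum q = .inl Q → Q.death ≤ shift δ (shift δ Q.birth)) :
    Point.d p.1.1 q.1.1 ≤ ENNReal.ofReal δ := by
  obtain ⟨⟨_ | _ | _, i⟩, hi⟩ := p <;> obtain ⟨⟨_ | _ | _, j⟩, hj⟩ := q <;>
    simp only [Diagram.Represents.toSum, Sum.inl.injEq, reduceCtorEq, forall_eq', Bar.birth,
      Bar.death, shift_coe, EReal.coe_le_coe_iff, top_le_iff, EReal.coe_ne_top] at hp hq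
  · refine ENNReal.ofReal_le_ofReal (min_le_of_right_le (max_le ?_ ?_)) <;> linarith
  · exact ENNReal.ofReal_le_ofReal (by linarith)
  · exact ENNReal.ofReal_le_ofReal (by linarith)
  · exact bot_le

/-- A bijection extending a partial matching of countable sets, after adding countably many
points. -/
theorem exists_equiv_extending {A B C : Type*} [Countable A] [Countable B] (f : C → A) (g : C → B)
    (hf : Function.Injective f) (hg : Function.Injective g) :
    ∃ σ : A ⊕ ℕ ≃ B ⊕ ℕ, ∀ x, (∃ c, x = .inl (f c) ∧ σ x = .inl (g c)) ∨
      ((∀ c, x ≠ .inl (f c)) ∧ ∀ c, σ x ≠ .inl (g c)) := by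
  classical
  have hf' : Function.Injective fun c => (.inl (f c) : A ⊕ ℕ) := Sum.inl_injective.comp hf
  have hg' : Function.Injective fun c => (.inl (g c) : B ⊕ ℕ) := Sum.inl_injective.comp hg
  have : Infinite ↥(Set.range fun c => (.inl (f c) : A ⊕ ℕ))ᶜ :=
    .of_injective (fun n : ℕ => ⟨.inr n, by simp⟩) fun m n h => by simpa using h
  have : Infinite ↥(Set.range fun c => (.inl (g c) : B ⊕ ℕ))ᶜ :=
    .of_injective (fun n : ℕ => ⟨.inr n, by simp⟩) fun m n h => by simpa using h
  -- Both complements are countable, and infinite because they contain the copy of `ℕ`.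
  obtain ⟨τ⟩ := nonempty_equiv_of_countable (α := ↥(Set.range fun c => (.inl (f c) : A ⊕ ℕ))ᶜ)
    (β := ↥(Set.range fun c => (.inl (g c) : B ⊕ ℕ))ᶜ)
  let ρ := (Equiv.ofInjective _ hf').symm.trans (Equiv.ofInjective _ hg')
  refine ⟨(Equiv.Set.sumCompl _).symm.trans
    ((Equiv.sumCongr ρ τ).trans (Equiv.Set.sumCompl _)), fun x => ?_⟩
  by_cases hx : x ∈ Set.range fun c => (.inl (f c) : A ⊕ ℕ)
  · obtain ⟨c, rfl⟩ := hx
    refine .inl ⟨c, rfl, ?_⟩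
    have : ρ ⟨.inl (f c), c, rfl⟩ = ⟨.inl (g c), c, rfl⟩ := by
      rw [Equiv.trans_apply, show (⟨.inl (f c), c, rfl⟩ : Set.range fun c => (.inl (f c) : A ⊕ ℕ)) =
        Equiv.ofInjective _ hf' c from rfl, Equiv.symm_apply_apply]
      rfl
    simp only [Equiv.trans_apply]
    rw [Equiv.Set.sumCompl_symm_apply_of_mem (Set.mem_range_self c), Equiv.sumCongr_apply,
      Sum.map_inl, this,
      Equiv.Set.sumCompl_apply_inl]
  · refine .inr ⟨fun c h => hx ⟨c, h.symm⟩, fun c h => ?_⟩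
    simp only [Equiv.trans_apply] at h
    rw [Equiv.Set.sumCompl_symm_apply_of_notMem hx, Equiv.sumCongr_apply, Sum.map_inr,
      Equiv.Set.sumCompl_apply_inr] at h
    exact (τ ⟨x, hx⟩).2 ⟨c, h.symm⟩

theorem bottleneck_le_of_matching {D E : Diagram} {r s t : EReal → EReal → ℕ}
    (hr : IsRankFunction r) (hs : IsRankFunction s) (hD : D.Represents r) (hE : E.Represents s)
    {δ : ℝ} (ι₁ : Bar t → Bar r) (ι₂ : Bar t → Bar s) (inj₁ : Function.Injective ι₁)
    (inj₂ : Function.Injective ι₂)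
    (hclose : ∀ p, (ι₁ p).birth ≤ shift δ (ι₂ p).birth ∧ (ι₂ p).birth ≤ shift δ (ι₁ p).birth ∧
      (ι₁ p).death ≤ shift δ (ι₂ p).death ∧ (ι₂ p).death ≤ shift δ (ι₁ p).death)
    (h₁ : ∀ q : Bar r, shift δ (shift δ q.birth) < q.death → q ∈ Set.range ι₁)
    (h₂ : ∀ q : Bar s, shift δ (shift δ q.birth) < q.death → q ∈ Set.range ι₂) :
    bottleneck D E ≤ ENNReal.ofReal δ := by
  have := countable_bar hr
  have := countable_bar hs
  obtain ⟨σ, hσ⟩ := exists_equiv_extending ι₁ ι₂ inj₁ inj₂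
  let Φ := Equiv.ofBijective _ hD.toSum_bijective
  let Ψ := Equiv.ofBijective _ hE.toSum_bijective
  refine iInf_le_of_le ((Φ.trans σ).trans Ψ.symm) (iSup_le fun p => ?_)
  have hq : hE.toSum (((Φ.trans σ).trans Ψ.symm) p) = σ (hD.toSum p) := Ψ.apply_symm_apply _
  rcases hσ (hD.toSum p) with ⟨c, e₁, e₂⟩ | ⟨e₁, e₂⟩
  · exact d_le_of_close hD hE e₁ (hq.trans e₂) (hclose c)
  · refine d_le_of_short hD hE (fun P hP => ?_) fun Q hQ => ?_
    · by_contra! hlt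
      obtain ⟨c, rfl⟩ := h₁ P hlt
      exact e₁ c hP
    · by_contra! hlt
      obtain ⟨c, rfl⟩ := h₂ Q hlt
      exact e₂ c (hq.symm.trans hQ)

end Diagrams

/-! ### Stability of persistence diagrams -/

section Stability

variable {X : Type u} [TopologicalSpace X] {F : Type v} [Field F] {k : ℤ}

theorem sublevelSet_subset_shift {f g : C(X, ℝ)} {δ : ℝ} (h : ∀ x, g x ≤ f x + δ) (a : EReal) :
    sublevelSet f a ⊆ sublevelSet g (shift δ a) := fun x hx =>
  (EReal.coe_le_coe_iff.2 (h x)).trans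
    ((shift_coe δ (f x)).symm.trans_le ((shift δ).monotone hx))

/-- Stability of persistence diagrams of tame functions. -/
theorem bottleneck_dgm_le [CompactSpace X] {f g : C(X, ℝ)} (hf : IsTame F k f)
    (hg : IsTame F k g) {δ : ℝ} (hδ : 0 ≤ δ) (h : ∀ x, |f x - g x| ≤ δ) :
    bottleneck (dgm F k f) (dgm F k g) ≤ ENNReal.ofReal δ := by
  have hfg := sublevelSet_subset_shift (f := f) (g := g) (δ := δ) fun x => by
    linarith [(abs_le.1 (h x)).1]
  have hgf := sublevelSet_subset_shift (f := g) (g := f) (δ := δ) fun x => by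
    linarith [(abs_le.1 (h x)).2]
  have hr₁ := isRankFunction_of_isTame hf
  have hr₂ := isRankFunction_of_isTame hg
  let e := shift δ
  have he : ∀ x, x ≤ e x := le_shift hδ
  have het : ∀ {x}, x ≠ ⊤ → e x ≠ ⊤ := fun {x} hx hx' => hx ((map_eq_top_iff (f := e)).1 hx')
  have mf : Monotone (sublevelSet f) := fun _ _ => sublevelSet_mono f
  have mg : Monotone (sublevelSet g) := fun _ _ => sublevelSet_mono g
  have hsub : ∀ a b, a < b → sublevelSet f a ⊆ sublevelSet g (e b) := fun a b hab =>
    (mf hab.le).trans (hfg b)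
  -- The map factors through the finite-rank map between the sublevel sets of `f` at `a` and `b`.
  have hfin : ∀ a b, a < b → b ≠ ⊤ → FiniteRank F k (sublevelSet f a) (sublevelSet g (e b)) :=
    fun a b hab hb => (finiteRank_of_isTame hf hab hb).mono le_rfl (mf hab.le) (hfg b)
  have hr' : IsRankFunction (pairRank F k (sublevelSet f) fun b => sublevelSet g (e b)) :=
    isRankFunction_pairRank mf (mg.comp e.monotone) (sublevelSet_bot f) hsub hfin
  -- Away from `⊤`, the four conditions are `inclRank_box` for the chains `f_{a₁} ⊆ f_{a₂} ⊆ f_d ⊆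
  -- g_{d+δ}`, `f_{a₁} ⊆ f_{a₂} ⊆ g_{d+δ} ⊆ f_{d+2δ}`, `f_a ⊆ g_{a+δ} ⊆ g_{b₁+δ} ⊆ g_{b₂+δ}` and
  -- `g_{a-δ} ⊆ f_a ⊆ g_{b₁+δ} ⊆ g_{b₂+δ}`.
  obtain ⟨ι₁, ι₂, inj₁, inj₂, hclose, h₁, h₂⟩ := exists_matching hr₁ hr₂ hr' e he
    (fun a₁ a₂ d h₁ h₂ => by
      by_cases hd : d = ⊤
      · simp [hd]
      · simp only [pairRank_of_ne _ _ _ hd]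
        exact inclRank_box (mf h₁) (mf h₂.le) (hfg d) (finiteRank_of_isTame hf h₂ hd))
    (fun a₁ a₂ d h₁ h₂ => by
      by_cases hd : d = ⊤
      · simp [hd]
      · simp only [pairRank_of_ne _ _ _ hd, pairRank_of_ne _ _ _ (het (het hd))]
        exact inclRank_box (mf h₁) (hsub _ _ h₂) (hgf _) (hfin _ _ h₂ hd))
    (fun a b₁ b₂ h₁ h₂ => by
      by_cases hb₁ : b₁ = ⊤
      · rw [hb₁, top_le_iff] at h₂
        simp [hb₁, h₂]
      · have hlt := e.strictMono h₁
        have hfga : sublevelSet f a ⊆ sublevelSet g (e a) := hfg a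
        have hfin' := finiteRank_of_isTame hg hlt (het hb₁)
        simp only [pairRank_of_ne _ _ _ hb₁, pairRank_of_ne _ _ _ (het hb₁)]
        by_cases hb₂ : b₂ = ⊤
        · simpa [hb₂] using inclRank_mono_left hfga (mg hlt.le) hfin'
        · simp only [pairRank_of_ne _ _ _ hb₂, pairRank_of_ne _ _ _ (het hb₂)]
          have := inclRank_box hfga (mg hlt.le) (mg (e.monotone h₂)) hfin'
          omega)
    (fun a b₁ b₂ h₁ h₂ => by
      have hga : sublevelSet g (e.symm a) ⊆ sublevelSet f a := by
        have := hgf (e.symm a)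
        rwa [show shift δ (e.symm a) = a from e.apply_symm_apply a] at this
      by_cases hb₁ : b₁ = ⊤
      · rw [hb₁, top_le_iff] at h₂
        simp [hb₁, h₂]
      · simp only [pairRank_of_ne _ _ _ hb₁, pairRank_of_ne _ _ _ (het hb₁)]
        by_cases hb₂ : b₂ = ⊤
        · simpa [hb₂] using inclRank_mono_left hga (hsub _ _ h₁) (hfin _ _ h₁ hb₁)
        · simp only [pairRank_of_ne _ _ _ hb₂, pairRank_of_ne _ _ _ (het hb₂)]
          have := inclRank_box hga (hsub _ _ h₁) (mg (e.monotone h₂)) (hfin _ _ h₁ hb₁)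
          omega)
  exact bottleneck_le_of_matching hr₁ hr₂ (represents_dgm hf) (represents_dgm hg) ι₁ ι₂ inj₁ inj₂
    hclose h₁ h₂

end Stability

end ConvexMatching
namespace ConvexMatching

/-! ### The bottleneck distance as an extended pseudo-metric -/

section BottleneckMetric

theorem Point.d_self (p : Point) : p.d p = 0 := by
  cases p with
  | proper a b hab =>
    refine ENNReal.ofReal_eq_zero.2 (min_le_of_left_le ?_)
    simp
  | essential a => simp [Point.d]
  | diag => rfl

theorem Point.d_comm (p q : Point) : p.d q = q.d p := by
  rcases p with ⟨a, b, hab⟩ | a | _ <;> rcases q with ⟨a', b', hab'⟩ | a' | _ <;>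
    simp only [Point.d]
  · rw [abs_sub_comm a, abs_sub_comm b, max_comm ((b - a) / 2)]
  · rw [abs_sub_comm]

theorem Point.d_triangle (p q r : Point) : p.d r ≤ p.d q + q.d r := by
  have key : ∀ {x y z : ℝ}, x ≤ y + z → 0 ≤ y → 0 ≤ z →
      ENNReal.ofReal x ≤ ENNReal.ofReal y + ENNReal.ofReal z := fun h hy hz =>
    (ENNReal.ofReal_le_ofReal h).trans (ENNReal.ofReal_add hy hz).le
  cases p with
  | proper a b hab =>
    have hp : 0 < b - a := by linarith
    cases q with
    | proper a' b' hab' =>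
      have hq : 0 < b' - a' := by linarith
      have e₁ := le_abs_self (a - a')
      have e₂ := neg_abs_le (a - a')
      have e₃ := le_abs_self (b - b')
      have e₄ := neg_abs_le (b - b')
      cases r with
      | proper a'' b'' hab'' =>
        have hr : 0 < b'' - a'' := by linarith
        have e₅ := le_abs_self (a' - a'')
        have e₆ := neg_abs_le (a' - a'')
        have e₇ := le_abs_self (b' - b'')
        have e₈ := neg_abs_le (b' - b'')
        have t₁ := abs_sub_le a a' a''
        have t₂ := abs_sub_le b b' b''
        refine key ?_ (le_min (by positivity) (by positivity))
          (le_min (by positivity) (by positivity))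
        -- If both minima are coordinate distances, these add up. Otherwise half-persistences are
        -- compared; they change by at most the coordinate distance.
        rcases min_cases (max |a - a'| |b - b'|) (max ((b - a) / 2) ((b' - a') / 2)) with h | h <;>
        rcases min_cases (max |a' - a''| |b' - b''|) (max ((b' - a') / 2) ((b'' - a'') / 2)) with
          h' | h' <;> rw [h.1, h'.1] <;> clear h h'
        · refine min_le_of_left_le (max_le ?_ ?_)
          · exact t₁.trans (add_le_add (le_max_left _ _) (le_max_left _ _))
          · exact t₂.trans (add_le_add (le_max_right _ _) (le_max_right _ _))
        all_goals
          refine min_le_of_right_le (max_le ?_ ?_) <;>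
          linarith [le_max_left |a - a'| |b - b'|, le_max_right |a - a'| |b - b'|,
            le_max_left |a' - a''| |b' - b''|, le_max_right |a' - a''| |b' - b''|,
            le_max_left ((b - a) / 2) ((b' - a') / 2), le_max_right ((b - a) / 2) ((b' - a') / 2),
            le_max_left ((b' - a') / 2) ((b'' - a'') / 2),
            le_max_right ((b' - a') / 2) ((b'' - a'') / 2)]
      | essential => simp [Point.d]
      | diag =>
        refine key ?_ (le_min (by positivity) (by positivity)) (by positivity)
        rcases min_cases (max |a - a'| |b - b'|) (max ((b - a) / 2) ((b' - a') / 2)) with h | h <;>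
          rw [h.1] <;> linarith [le_max_left |a - a'| |b - b'|, le_max_right |a - a'| |b - b'|,
            le_max_left ((b - a) / 2) ((b' - a') / 2)]
    | essential => simp [Point.d]
    | diag =>
      cases r with
      | proper a'' b'' hab'' =>
        refine key (min_le_of_right_le (max_le ?_ ?_)) ?_ ?_ <;> linarith
      | essential => simp [Point.d]
      | diag => simp [Point.d]
  | essential a =>
    cases q <;> cases r <;> simp only [Point.d, top_add, add_top, le_top]
    exact key (abs_sub_le _ _ _) (abs_nonneg _) (abs_nonneg _)
  | diag =>
    cases q with
    | proper a b hab =>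
      have hp : 0 < b - a := by linarith
      cases r with
      | proper a' b' hab' =>
        have hr : 0 < b' - a' := by linarith
        refine key ?_ (by positivity) (le_min (by positivity) (by positivity))
        rcases min_cases (max |a - a'| |b - b'|) (max ((b - a) / 2) ((b' - a') / 2)) with h | h <;>
          rw [h.1] <;> linarith [le_max_left |a - a'| |b - b'|, le_max_right |a - a'| |b - b'|,
            le_max_right ((b - a) / 2) ((b' - a') / 2), neg_abs_le (a - a'), le_abs_self (a - a'),
            le_abs_self (b - b'), neg_abs_le (b - b')]
      | essential => simp [Point.d]
      | diag => simp [Point.d]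
    | essential => cases r <;> simp [Point.d]
    | diag => cases r <;> simp [Point.d]

theorem bottleneck_self (D : Diagram) : bottleneck D D = 0 :=
  nonpos_iff_eq_zero.1 <| iInf_le_of_le (Equiv.refl _) <| iSup_le fun p => (Point.d_self p.1.1).le

theorem bottleneck_le_comm (D E : Diagram) : bottleneck D E ≤ bottleneck E D :=
  le_iInf fun σ => iInf_le_of_le σ.symm <| iSup_le fun p => by
    have := le_iSup (fun q : E.Elem => Point.d q.1.1 (σ q).1.1) (σ.symm p)
    rwa [σ.apply_symm_apply, Point.d_comm] at this

theorem bottleneck_comm (D E : Diagram) : bottleneck D E = bottleneck E D :=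
  (bottleneck_le_comm D E).antisymm (bottleneck_le_comm E D)

theorem bottleneck_triangle (D E G : Diagram) :
    bottleneck D G ≤ bottleneck D E + bottleneck E G := by
  refine ENNReal.le_iInf_add_iInf fun σ τ => iInf_le_of_le (σ.trans τ) (iSup_le fun p => ?_)
  exact (Point.d_triangle _ (σ p).1.1 _).trans (add_le_add
    (le_iSup (fun p : D.Elem => Point.d p.1.1 (σ p).1.1) p)
    (le_iSup (fun q : E.Elem => Point.d q.1.1 (τ q).1.1) (σ p)))

end BottleneckMetric

/-! ### The convex matching distance -/

section Cmd

variable {X : Type u} [TopologicalSpace X] {F : Type v} [Field F] {k : ℤ}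

theorem cmd_nonneg (φ ψ : C(X, ℝ × ℝ)) : 0 ≤ cmd F k φ ψ :=
  Real.sSup_nonneg (by
    rintro _ ⟨t, -, rfl⟩
    exact ENNReal.toReal_nonneg)

theorem cmd_comm (φ ψ : C(X, ℝ × ℝ)) : cmd F k φ ψ = cmd F k ψ φ := by
  simp only [cmd, sliceDist, bottleneck_comm (dgm F k (convexComb φ _))]

theorem cmd_eq_zero {φ ψ : C(X, ℝ × ℝ)}
    (h : ∀ t, dgm F k (convexComb φ t) = dgm F k (convexComb ψ t)) : cmd F k φ ψ = 0 := by
  have : (fun t : ℝ => (sliceDist F k φ ψ t).toReal) = fun _ => 0 := by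
    funext t
    rw [sliceDist, h, bottleneck_self, ENNReal.toReal_zero]
  rw [cmd, this, (Set.nonempty_Icc.2 zero_le_one).image_const, csSup_singleton]

variable [CompactSpace X]

theorem exists_norm_le (φ : C(X, ℝ × ℝ)) : ∃ C : ℝ, 0 ≤ C ∧ ∀ x, |(φ x).1| ≤ C ∧ |(φ x).2| ≤ C :=
  ⟨‖φ‖, norm_nonneg _, fun x => ⟨(norm_fst_le (φ x)).trans (φ.norm_coe_le_norm x),
    (norm_snd_le (φ x)).trans (φ.norm_coe_le_norm x)⟩⟩

theorem exists_bottleneck_convexComb_le {φ : C(X, ℝ × ℝ)} (hφ : IsAdmissible F k φ) :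
    ∃ C : ℝ, 0 ≤ C ∧ ∀ s ∈ Set.Icc (0 : ℝ) 1, ∀ t ∈ Set.Icc (0 : ℝ) 1,
      bottleneck (dgm F k (convexComb φ s)) (dgm F k (convexComb φ t)) ≤
        ENNReal.ofReal (C * |s - t|) := by
  obtain ⟨C, hC, h⟩ := exists_norm_le φ
  refine ⟨2 * C, by positivity, fun s hs t ht =>
    bottleneck_dgm_le (hφ s hs) (hφ t ht) (by positivity) fun x => ?_⟩
  have e : convexComb φ s x - convexComb φ t x = ((φ x).2 - (φ x).1) * (s - t) := by
    simp only [convexComb, ContinuousMap.coe_mk]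
    ring
  rw [e, abs_mul]
  refine mul_le_mul_of_nonneg_right ?_ (abs_nonneg _)
  linarith [abs_sub (φ x).2 (φ x).1, (h x).1, (h x).2]

theorem sliceDist_ne_top {φ ψ : C(X, ℝ × ℝ)} (hφ : IsAdmissible F k φ) (hψ : IsAdmissible F k ψ)
    {t : ℝ} (ht : t ∈ Set.Icc (0 : ℝ) 1) : sliceDist F k φ ψ t ≠ ⊤ := by
  let C := ‖convexComb φ t - convexComb ψ t‖
  exact ((bottleneck_dgm_le (δ := C) (hφ t ht) (hψ t ht) (norm_nonneg _) fun x =>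
    (convexComb φ t - convexComb ψ t).norm_coe_le_norm x).trans_lt ENNReal.ofReal_lt_top).ne

theorem continuousOn_sliceDist {φ ψ : C(X, ℝ × ℝ)} (hφ : IsAdmissible F k φ)
    (hψ : IsAdmissible F k ψ) :
    ContinuousOn (fun t => (sliceDist F k φ ψ t).toReal) (Set.Icc 0 1) := by
  obtain ⟨C, hC, h⟩ := exists_bottleneck_convexComb_le hφ
  obtain ⟨C', hC', h'⟩ := exists_bottleneck_convexComb_le hψ
  -- Going from `φ^s` through `φ^t` and `ψ^t` to `ψ^s` changes the slice distance by at most the two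
  -- stability errors.
  refine (LipschitzOnWith.of_le_add_mul (C + C').toNNReal
    fun s hs t ht => ?_).continuousOn
  have key : sliceDist F k φ ψ s ≤ ENNReal.ofReal (C * |s - t|) + (sliceDist F k φ ψ t +
      ENNReal.ofReal (C' * |t - s|)) :=
    (bottleneck_triangle _ (dgm F k (convexComb φ t)) _).trans (add_le_add (h s hs t ht)
      ((bottleneck_triangle _ (dgm F k (convexComb ψ t)) _).trans
        (add_le_add le_rfl (h' t ht s hs))))
  have fin := sliceDist_ne_top hφ hψ ht
  have := ENNReal.toReal_mono (by finiteness) key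
  rw [ENNReal.toReal_add (by finiteness) (by finiteness), ENNReal.toReal_add fin (by finiteness),
    ENNReal.toReal_ofReal (by positivity), ENNReal.toReal_ofReal (by positivity),
    abs_sub_comm t s] at this
  rw [Real.dist_eq, Real.coe_toNNReal _ (add_nonneg hC hC')]
  linarith

theorem isGreatest_cmd {φ ψ : C(X, ℝ × ℝ)} (hφ : IsAdmissible F k φ) (hψ : IsAdmissible F k ψ) :
    IsGreatest ((fun t : ℝ => (sliceDist F k φ ψ t).toReal) '' Set.Icc 0 1) (cmd F k φ ψ) :=
  (isCompact_Icc.image_of_continuousOn (continuousOn_sliceDist hφ hψ)).isGreatest_sSup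
    ((Set.nonempty_Icc.2 zero_le_one).image _)

theorem cmd_triangle {φ ξ ψ : C(X, ℝ × ℝ)} (hφ : IsAdmissible F k φ) (hξ : IsAdmissible F k ξ)
    (hψ : IsAdmissible F k ψ) : cmd F k φ ψ ≤ cmd F k φ ξ + cmd F k ξ ψ := by
  -- At a parameter attaining the left-hand maximum, the triangle inequality for diagrams suffices.
  obtain ⟨t, ht, e⟩ := (isGreatest_cmd hφ hψ).1
  rw [← e]
  have fin₁ := sliceDist_ne_top hφ hξ ht
  have fin₂ := sliceDist_ne_top hξ hψ ht
  have key : sliceDist F k φ ψ t ≤ sliceDist F k φ ξ t + sliceDist F k ξ ψ t :=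
    bottleneck_triangle _ _ _
  have := ENNReal.toReal_mono (by finiteness) key
  rw [ENNReal.toReal_add fin₁ fin₂] at this
  exact this.trans (add_le_add ((isGreatest_cmd hφ hξ).2 ⟨t, ht, rfl⟩)
    ((isGreatest_cmd hξ hψ).2 ⟨t, ht, rfl⟩))

end Cmd

/-! ### Invariance under homeomorphisms and failure of definiteness -/

section Homeomorphism

open CategoryTheory

variable {X Y : Type u} [TopologicalSpace X] [TopologicalSpace Y] (F : Type v) [Field F] (k : ℤ)

/-- Sublevel sets correspond under a homeomorphism. -/
def sublevelIso (h : X ≃ₜ Y) (f : C(Y, ℝ)) (a : ℝ) :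
    sublevel (f.comp (h : C(X, Y))) a ≅ sublevel f a :=
  TopCat.isoOfHomeo (h.subtype fun _ => Iff.rfl)

theorem betti_comp_homeomorph (h : X ≃ₜ Y) (f : C(Y, ℝ)) (a b : ℝ) :
    betti F k (f.comp (h : C(X, Y))) a b = betti F k f a b := by
  unfold betti
  split_ifs with hab
  · have comm : sublevelIncl (f.comp (h : C(X, Y))) hab ≫ (sublevelIso h f b).hom =
        (sublevelIso h f a).hom ≫ sublevelIncl f hab := rfl
    let e := fun c => ((homologyFunctor.{u, v} F k).mapIso (sublevelIso h f c)).toLinearEquiv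
    have := congrArg ModuleCat.Hom.hom (congrArg (homologyFunctor.{u, v} F k).map comm)
    rw [Functor.map_comp, Functor.map_comp, ModuleCat.hom_comp, ModuleCat.hom_comp] at this
    have hmap : (persistentHomology F k (f.comp (h : C(X, Y))) hab).map
        (e b : _ →ₗ[F] _) = persistentHomology F k f hab := by
      unfold persistentHomology
      rw [← LinearMap.range_comp]
      refine (congrArg LinearMap.range this).trans (LinearMap.range_comp_of_range_eq_top _ ?_)
      exact (e a).range
    rw [← hmap]
    exact ((e b).finrank_map_eq _).symm
  · rfl

theorem dgm_comp_homeomorph (h : X ≃ₜ Y) (f : C(Y, ℝ)) :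
    dgm F k (f.comp (h : C(X, Y))) = dgm F k f := by
  funext p
  cases p <;> simp only [dgm, properMult, essentialMult, betti_comp_homeomorph]

/-- Convex combinations commute with precomposition by `h`, so all slices have equal diagrams. -/
theorem cmd_comp_homeomorph (h : X ≃ₜ X) (φ : C(X, ℝ × ℝ)) :
    cmd F k (φ.comp (h : C(X, X))) φ = 0 :=
  cmd_eq_zero fun t => by
    rw [← dgm_comp_homeomorph F k h (convexComb φ t)]
    rfl

/-- Sublevel sets are again finite and totally disconnected, so their homology is
finite-dimensional. -/
theorem isTame_of_finite [Finite X] [TotallyDisconnectedSpace X] (f : C(X, ℝ)) :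
    IsTame F k f := by
  intro a b hab
  have : Finite (sublevel f a) := inferInstanceAs (Finite {x : X // f x ≤ a})
  have : TotallyDisconnectedSpace (sublevel f a) :=
    inferInstanceAs (TotallyDisconnectedSpace {x : X // f x ≤ a})
  have := finite_homology (F := F) (k := k) (sublevel f a)
  unfold persistentHomology
  infer_instance

theorem isAdmissible_of_finite [Finite X] [TotallyDisconnectedSpace X] (φ : C(X, ℝ × ℝ)) :
    IsAdmissible F k φ := fun _ _ => isTame_of_finite F k _

theorem exists_comp_ne : ∃ (φ : C(ULift.{u} Bool, ℝ × ℝ)) (h : ULift.{u} Bool ≃ₜ ULift.{u} Bool),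
    φ.comp (h : C(ULift.{u} Bool, ULift.{u} Bool)) ≠ φ := by
  refine ⟨⟨fun x => if x.down then (1, 1) else (0, 0), continuous_of_discreteTopology⟩,
    (Equiv.ulift.trans (Equiv.boolNot.trans Equiv.ulift.symm)).toHomeomorphOfDiscrete,
    fun e => ?_⟩
  have : ((0, 0) : ℝ × ℝ) = (1, 1) := DFunLike.congr_fun e ⟨true⟩
  exact zero_ne_one (congrArg Prod.fst this)

theorem exists_cmd_eq_zero :
    ∃ (X : Type u) (_ : TopologicalSpace X) (_ : CompactSpace X) (φ ψ : C(X, ℝ × ℝ)),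
      IsAdmissible F k φ ∧ IsAdmissible F k ψ ∧ φ ≠ ψ ∧ cmd F k φ ψ = 0 := by
  obtain ⟨φ, h, hne⟩ := exists_comp_ne
  have hφ := isAdmissible_of_finite F k φ
  have hφh := isAdmissible_of_finite F k (φ.comp (h : C(ULift.{u} Bool, ULift.{u} Bool)))
  have hcmd := cmd_comp_homeomorph F k h φ
  exact ⟨ULift.{u} Bool, inferInstance, inferInstance, _, φ, hφh, hφ, hne, hcmd⟩

end Homeomorphism

end ConvexMatching

open ConvexMatching in
theorem proposition1 (F : Type v) [Field F] (k : ℤ) :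
    (∀ (X : Type u) [TopologicalSpace X] [CompactSpace X],
      (∀ φ ψ : C(X, ℝ × ℝ), IsAdmissible F k φ → IsAdmissible F k ψ →
        (∀ t ∈ Set.Icc (0 : ℝ) 1, sliceDist F k φ ψ t ≠ ⊤) ∧
        IsGreatest ((fun t : ℝ => (sliceDist F k φ ψ t).toReal) '' Set.Icc 0 1) (cmd F k φ ψ) ∧
        0 ≤ cmd F k φ ψ ∧
        cmd F k φ ψ = cmd F k ψ φ) ∧
      (∀ φ : C(X, ℝ × ℝ), IsAdmissible F k φ → cmd F k φ φ = 0) ∧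
      (∀ φ ξ ψ : C(X, ℝ × ℝ), IsAdmissible F k φ → IsAdmissible F k ξ → IsAdmissible F k ψ →
        cmd F k φ ψ ≤ cmd F k φ ξ + cmd F k ξ ψ)) ∧
    (∃ (X : Type u) (_ : TopologicalSpace X) (_ : CompactSpace X) (φ ψ : C(X, ℝ × ℝ)),
      IsAdmissible F k φ ∧ IsAdmissible F k ψ ∧ φ ≠ ψ ∧ cmd F k φ ψ = 0) :=
  ⟨fun _ _ _ => ⟨fun φ ψ hφ hψ => ⟨fun _ ht => sliceDist_ne_top hφ hψ ht, isGreatest_cmd hφ hψ,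
      cmd_nonneg φ ψ, cmd_comm φ ψ⟩, fun _ _ => cmd_eq_zero fun _ => rfl,
      fun _ _ _ hφ hξ hψ => cmd_triangle hφ hξ hψ⟩,
    exists_cmd_eq_zero F k⟩
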